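/- **Setting.** Let $e$ be a strictly increasing, convex, continuous real function on an interval $I\subseteq\mathbb R$ which is $C^2$ with $e''>0$ in the interior of $I$, and let $\ell\colon e(I)\to I$ be its inverse. A real function $F$ on a convex set $S$ is called $\ell$-convex if $F=e\circ g$ for some convex function $g\colon S\to I$. If $F$ takes values in $[0,\infty]$, then $F$ is called $\ell$-convex if $S$ is convex, the set $\{F<\infty\}$ is convex and $F$ is $\ell$-convex on it (i.e. $F=e\circ g$ with $g\colon S\to I\cup\{\infty\}$ convex and $e(\infty)=\infty$). The function $\ell'/\ell''$ is considered in the interior of $e(I)$. It is called homogeneous if $e(I)$ is stable under multiplication by positive numbers and $(\ell'/\ell'')(st)=s\,(\ell'/\ell'')(t)$ for all $s>0$ and all $t$ in the interior of $e(I)$. Let $A$ be a C*-algebra and let $A_1,\dots,A_n$ be C*-subalgebras with $ab=ba$ for all $a\in A_i$, $b\in A_j$, $i\neq j$. For intervals $I_1,\dots,I_n$ let $(A_i)_{\mathrm{sa}}^{I_i}$ be the set of self-adjoint $x\in A_i$ with spectrum contained in $I_i$; spectra are taken in $A$ if $A$ is unital and in its unitization otherwise. For $\underline x=(x_1,\dots,x_n)$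 in $\bigoplus_i (A_i)_{\mathrm{sa}}^{I_i}$ and $f$ continuous on $I_1\times\dots\times I_n$, let $f(\underline x)$ be given by the joint continuous functional calculus: it is the element of the commutative unital C*-algebra generated by $x_1,\dots,x_n$ (and by the unit of $A$, or of its unitization) with $\chi(f(\underline x))=f(\chi(x_1),\dots,\chi(x_n))$ for all characters $\chi$ of that algebra. A trace is an additive, positively homogeneous map $\tau\colon A_+\to[0,\infty]$ with $\tau(x^*x)=\tau(xx^*)$ for all $x\in A$; it is densely defined if $\{\tau<\infty\}$ is dense in $A_+$. For a positive element $y$ of the unitization of a non-unital $A$ we put $\tau(y)=\sup\{\tau(a): a\in A,\ 0\le a\le y\}$, which agrees with the given value when $y\in A_+$. A tracial state on a unital $A$ is a positive linear functional $\tau$ with $\tau(\mathbf 1)=1$ and $\tau(x^*x)=\tau(xx^*)$ for all $x$. **Theorem 3 ($\ell$-Convex Trace Functions).** Let $f$ be a continuous function on a cube $I_1\times\dots\times I_n$ in $\mathbb R^n$, where the $I_i$ are intervals. Assume that $f$ is $\ell$-convex relative to a pair $e,\ell$ as above, and that $\ell'/\ell''$ is convex. If $A_1,\dots,A_n$ are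 mutually commuting C*-subalgebras of a unital C*-algebra $A$ and $\tau$ is a tracial state on $A$, then the function $$(x_1,\dots,x_n)\longmapsto\tau(f(x_1,\dots,x_n))$$ is $\ell$-convex on $\bigoplus_i (A_i)_{\mathrm{sa}}^{I_i}$. If moreover $\ell'/\ell''$ is homogeneous and $f\ge 0$, then for every C*-algebra $A$, unital or not, with mutually commuting C*-subalgebras $A_1,\dots,A_n$ and every densely defined, lower semicontinuous trace $\tau$ on $A$ (with $\tau\neq0$ in case $0\notin e(I)$), the $[0,\infty]$-valued function $(x_1,\dots,x_n)\mapsto\tau(f(x_1,\dots,x_n))$ is $\ell$-convex on $\bigoplus_i (A_i)_{\mathrm{sa}}^{I_i}$. -/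

import Mathlib

open Set
open scoped ENNReal NNReal ComplexOrder

/-! ### The pair `e`, `ℓ` and `ℓ`-convexity -/

/-- `e` is a strictly increasing, convex, continuous function on the interval `I`, which is `C²`
with positive second derivative in the interior of `I`, and `ℓ`, defined on `e(I)`, is the inverse
function of `e`. (`ConvexOn ℝ I e` contains the convexity of `I`.) -/
structure IsEllPair (e l : ℝ → ℝ) (I : Set ℝ) : Prop where
  strictMono : StrictMonoOn e I
  convex : ConvexOn ℝ I e
  continuous : ContinuousOn e I
  contDiff : ContDiffOn ℝ 2 e (interior I)
  deriv2_pos : ∀ s ∈ interior I, 0 < deriv (deriv e) s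
  leftInv : LeftInvOn l e I

/-- The function `ℓ' / ℓ''`. It is only used in the interior of `e(I)`. -/
noncomputable def ellQuot (l : ℝ → ℝ) (t : ℝ) : ℝ := deriv l t / deriv (deriv l) t

/-- `ℓ' / ℓ''` is homogeneous: the domain `J` of `ℓ` is stable under multiplication with positive
numbers, and `(ℓ'/ℓ'')(s t) = s (ℓ'/ℓ'')(t)` for `s > 0`. -/
def HomogeneousEllQuot (l : ℝ → ℝ) (J : Set ℝ) : Prop :=
  (∀ s > 0, ∀ t ∈ J, s * t ∈ J) ∧
    ∀ s > 0, ∀ t ∈ interior J, ellQuot l (s * t) = s * ellQuot l t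

/-- A real function `F` on a convex set `S` is `ℓ`-convex, where `ℓ` is the inverse of
`e : I → ℝ`, if `F = e ∘ g` for a convex function `g : S → I`. -/
def EllConvexOn {E : Type*} [AddCommGroup E] [Module ℝ E] (e : ℝ → ℝ) (I : Set ℝ) (S : Set E)
    (F : E → ℝ) : Prop :=
  ∃ g : E → ℝ, ConvexOn ℝ S g ∧ MapsTo g S I ∧ EqOn F (e ∘ g) S

/-- The same notion for functions with values in `[0, ∞]`: `F = e ∘ g` for a convex function
`g : S → I ∪ {∞}`, where `e(∞) = ∞`. -/
def ExtEllConvexOn {E : Type*} [AddCommGroup E] [Module ℝ E] (e : ℝ → ℝ) (I : Set ℝ) (S : Set E)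
    (F : E → ℝ≥0∞) : Prop :=
  Convex ℝ S ∧ EllConvexOn e I {x ∈ S | F x ≠ ∞} (fun x => (F x).toReal)

/-! ### Functions of several commuting self-adjoint elements -/

section JointCalculus

variable {A : Type*} [CStarAlgebra A] {n : ℕ}

/-- The unital C⋆-subalgebra generated by `x₁, …, xₙ`. -/
noncomputable def jointAlgebra (x : Fin n → A) : StarSubalgebra ℂ A :=
  (StarAlgebra.adjoin ℂ (range x)).topologicalClosure

lemma mem_jointAlgebra (x : Fin n → A) (i : Fin n) : x i ∈ jointAlgebra x :=
  StarSubalgebra.le_topologicalClosure _ (StarAlgebra.subset_adjoin ℂ _ (mem_range_self i))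

/-- `y = f(x₁, …, xₙ)`: the element `y` of the C⋆-algebra generated by `x₁, …, xₙ` satisfies
`χ(y) = f(χ(x₁), …, χ(xₙ))` for all characters `χ` of that algebra. -/
def IsJointCfc (f : (Fin n → ℝ) → ℝ) (x : Fin n → A) (y : A) : Prop :=
  ∃ hy : y ∈ jointAlgebra x, ∀ χ : jointAlgebra x →⋆ₐ[ℂ] ℂ,
    χ ⟨y, hy⟩ = ((f fun i => (χ ⟨x i, mem_jointAlgebra x i⟩).re : ℝ) : ℂ)

open Classical in
/-- The element `f(x₁, …, xₙ)` for commuting self-adjoint elements `x₁, …, xₙ` and a function `f`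
that is continuous on a product of sets containing the spectra of the `xᵢ`; see
`existsUnique_isJointCfc` and `isJointCfc_jointCfc`. -/
noncomputable def jointCfc (f : (Fin n → ℝ) → ℝ) (x : Fin n → A) : A :=
  if h : ∃ y, IsJointCfc f x y then h.choose else 0

/-- A function on the character space of a commutative unital C⋆-algebra is the Gelfand transform of
a unique element. -/
lemma existsUnique_of_characters {C : Type*} [CommCStarAlgebra C] {f : (Fin n → ℝ) → ℝ}
    {x : Fin n → C} {K : Set (Fin n → ℝ)} (hf : ContinuousOn f K)
    (hK : ∀ χ : C →⋆ₐ[ℂ] ℂ, (fun i => (χ (x i)).re) ∈ K) :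
    ∃! y : C, ∀ χ : C →⋆ₐ[ℂ] ℂ, χ y = ((f fun i => (χ (x i)).re : ℝ) : ℂ) := by
  have toHom : ∀ φ : WeakDual.characterSpace ℂ C, ∃ χ : C →⋆ₐ[ℂ] ℂ, ∀ a, χ a = φ a := fun φ =>
    ⟨{ WeakDual.CharacterSpace.equivAlgHom φ with map_star' := fun a => map_star φ a },
      fun _ => rfl⟩
  have hcont : Continuous (fun φ : WeakDual.characterSpace ℂ C =>
      ((f fun i => (φ (x i)).re : ℝ) : ℂ)) := by
    refine Complex.continuous_ofReal.comp (hf.comp_continuous ?_ ?_)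
    · refine continuous_pi fun i => Complex.continuous_re.comp ?_
      exact (map_continuous (WeakDual.gelfandTransform ℂ C (x i)))
    · intro φ
      obtain ⟨χ, hχ⟩ := toHom φ
      simpa [hχ] using hK χ
  refine ⟨(gelfandStarTransform C).symm ⟨_, hcont⟩, ?_, ?_⟩
  · intro χ
    have h : gelfandStarTransform C ((gelfandStarTransform C).symm ⟨_, hcont⟩) = ⟨_, hcont⟩ :=
      (gelfandStarTransform C).apply_symm_apply _
    have h2 := DFunLike.congr_fun h (WeakDual.CharacterSpace.equivAlgHom.symm χ.toAlgHom)
    exact h2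
  · intro y hy
    rw [StarAlgEquiv.eq_symm_apply]
    ext φ
    obtain ⟨χ, hχ⟩ := toHom φ
    have := hy χ
    simp only [hχ] at this
    exact this

/-- For commuting self-adjoint `x₁, …, xₙ` with spectra in `K₁, …, Kₙ` and `f` continuous on
`K₁ × ⋯ × Kₙ` the element `f(x₁, …, xₙ)` exists and is unique. -/
theorem existsUnique_isJointCfc {f : (Fin n → ℝ) → ℝ} {x : Fin n → A} {K : Fin n → Set ℝ}
    (hf : ContinuousOn f (univ.pi K)) (hx : ∀ i, IsSelfAdjoint (x i))
    (hc : ∀ i j, Commute (x i) (x j)) (hK : ∀ i, spectrum ℝ (x i) ⊆ K i) :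
    ∃! y, IsJointCfc f x y := by
  have hcomm : ∀ a ∈ range x, ∀ b ∈ range x, a * b = b * a := by
    rintro _ ⟨i, rfl⟩ _ ⟨j, rfl⟩; exact hc i j
  have hcomm' : ∀ a ∈ range x, ∀ b ∈ range x, a * star b = star b * a := by
    rintro _ ⟨i, rfl⟩ _ ⟨j, rfl⟩; rw [(hx j).star_eq]; exact hc i j
  have : IsMulCommutative (StarAlgebra.adjoin ℂ (range x)) :=
    StarAlgebra.isMulCommutative_adjoin ℂ hcomm hcomm'
  have hcl : IsClosed (jointAlgebra x : Set A) := StarSubalgebra.isClosed_topologicalClosure _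
  let iC : CommCStarAlgebra (jointAlgebra x) :=
    { (StarSubalgebra.cstarAlgebra (jointAlgebra x) (h_closed := hcl) :
        CStarAlgebra (jointAlgebra x)) with
      mul_comm := (StarSubalgebra.commRingTopologicalClosure (StarAlgebra.adjoin ℂ (range x))
        (fun a b => mul_comm' a b)).mul_comm }
  have key := existsUnique_of_characters (C := jointAlgebra x) (f := f)
    (x := fun i => ⟨x i, mem_jointAlgebra x i⟩) hf (by
      intro χ i _
      refine hK i ((spectrum.algebraMap_mem_iff ℂ).1 ?_)
      have h1 : χ ⟨x i, mem_jointAlgebra x i⟩ ∈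
          spectrum ℂ (⟨x i, mem_jointAlgebra x i⟩ : jointAlgebra x) :=
        AlgHom.apply_mem_spectrum χ _
      rw [StarSubalgebra.spectrum_eq (hS := hcl)] at h1
      have h2 := (hx i).mem_spectrum_eq_re h1
      change ((χ ⟨x i, mem_jointAlgebra x i⟩).re : ℂ) ∈ _
      rw [← h2]
      exact h1)
  obtain ⟨y, hy, huniq⟩ := key
  refine ⟨y, ⟨y.2, hy⟩, ?_⟩
  rintro z ⟨hz, hz'⟩
  exact congrArg Subtype.val (huniq ⟨z, hz⟩ hz')

theorem isJointCfc_jointCfc {f : (Fin n → ℝ) → ℝ} {x : Fin n → A} {K : Fin n → Set ℝ}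
    (hf : ContinuousOn f (univ.pi K)) (hx : ∀ i, IsSelfAdjoint (x i))
    (hc : ∀ i j, Commute (x i) (x j)) (hK : ∀ i, spectrum ℝ (x i) ⊆ K i) :
    IsJointCfc f x (jointCfc f x) := by
  have h := (existsUnique_isJointCfc hf hx hc hK).exists
  rw [jointCfc, dif_pos h]
  exact h.choose_spec

end JointCalculus

/-! ### Traces and domains -/

/-- The C⋆-subalgebras `A₁, …, Aₙ` are mutually commuting. -/
def MutuallyCommuting {A : Type*} [NonUnitalCStarAlgebra A] {n : ℕ}
    (B : Fin n → NonUnitalStarSubalgebra ℂ A) : Prop :=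
  ∀ i j, i ≠ j → ∀ a ∈ B i, ∀ b ∈ B j, Commute a b

/-- A tracial state on a unital C⋆-algebra. -/
structure IsTracialState {A : Type*} [CStarAlgebra A] [PartialOrder A] [StarOrderedRing A]
    (τ : A →ₗ[ℂ] ℂ) : Prop where
  nonneg : ∀ a, 0 ≤ a → 0 ≤ τ a
  map_one : τ 1 = 1
  tracial : ∀ a, τ (star a * a) = τ (a * star a)

/-- A densely defined, lower semicontinuous trace `τ : A₊ → [0, ∞]`. The values of the function `τ`
outside `A₊` are irrelevant. -/
structure IsDenseLscTrace {A : Type*} [NonUnitalCStarAlgebra A] [PartialOrder A]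
    [StarOrderedRing A] (τ : A → ℝ≥0∞) : Prop where
  map_zero : τ 0 = 0
  map_add : ∀ a b, 0 ≤ a → 0 ≤ b → τ (a + b) = τ a + τ b
  map_smul : ∀ (r : ℝ≥0) (a : A), 0 ≤ a → τ ((r : ℝ) • a) = r * τ a
  tracial : ∀ a, τ (star a * a) = τ (a * star a)
  lsc : LowerSemicontinuousOn τ {a | 0 ≤ a}
  dense : {a : A | 0 ≤ a} ⊆ closure {a | 0 ≤ a ∧ τ a < ∞}

/-- The canonical extension of a trace on `A` to the positive elements `y` of the unitization of
`A`, `τ(y) = sup {τ(a) | a ∈ A, 0 ≤ a ≤ y}`; see `traceExt_inr`. -/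
noncomputable def traceExt {A : Type*} [NonUnitalCStarAlgebra A] [PartialOrder A]
    [StarOrderedRing A] (τ : A → ℝ≥0∞) (y : Unitization ℂ A) : ℝ≥0∞ :=
  ⨆ (a : A) (_ : 0 ≤ a) (_ : (a : Unitization ℂ A) ≤ y), τ a

/-- The extension agrees with `τ` on `A₊`. -/
theorem traceExt_inr {A : Type*} [NonUnitalCStarAlgebra A] [PartialOrder A] [StarOrderedRing A]
    {τ : A → ℝ≥0∞} (hτ : IsDenseLscTrace τ) {b : A} (hb : 0 ≤ b) :
    traceExt τ (b : Unitization ℂ A) = τ b := by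
  refine le_antisymm ?_ (le_iSup_of_le b (le_iSup_of_le hb (le_iSup_of_le le_rfl le_rfl)))
  refine iSup_le fun a => iSup_le fun ha => iSup_le fun hab => ?_
  have h : a ≤ b := (Unitization.inr_le_iff a b (.of_nonneg ha) (.of_nonneg hb)).1 hab
  have h2 := hτ.map_add a (b - a) ha (sub_nonneg.2 h)
  rw [add_sub_cancel] at h2
  rw [h2]
  exact le_self_add

/-- The set of tuples `(x₁, …, xₙ)` of self-adjoint elements `xᵢ ∈ Aᵢ` whose spectra in the unital
C⋆-algebra `A` are contained in `Kᵢ`. -/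
def saTuples {A : Type*} [CStarAlgebra A] {n : ℕ} (B : Fin n → NonUnitalStarSubalgebra ℂ A)
    (K : Fin n → Set ℝ) : Set (Fin n → A) :=
  {x | ∀ i, x i ∈ B i ∧ IsSelfAdjoint (x i) ∧ spectrum ℝ (x i) ⊆ K i}

/-- The same set if `A` need not be unital; spectra are now taken in the unitization of `A`
(`quasispectrum` is that spectrum). -/
def saTuplesNonUnital {A : Type*} [NonUnitalCStarAlgebra A] {n : ℕ}
    (B : Fin n → NonUnitalStarSubalgebra ℂ A) (K : Fin n → Set ℝ) : Set (Fin n → A) :=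
  {x | ∀ i, x i ∈ B i ∧ IsSelfAdjoint (x i) ∧ quasispectrum ℝ (x i) ⊆ K i}

/-!
By the Cauchy–Schwarz inequality, convexity of `ℓ'/ℓ''` makes every weighted quasi-arithmetic mean
`u ↦ ℓ (∑ wₖ e (uₖ))` convex; homogeneity of `ℓ'/ℓ''` allows weights of arbitrary total mass. To
compare the trace at `z = a x + b y` with the traces at `x` and `y`, take a fine partition of unity
`∑ dₖ² = 1` in the algebra generated by `z` and pinch the trace into the functionals `τ (dₖ · dₖ)`.
On each of them Jensen's inequality bounds `f(x)` and `f(y)` from below by the value of `f` at a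
barycenter of the joint spectrum, and for `f(z)` it is an equality up to `ε`. The barycenter of `z`
is the same combination of those of `x` and `y`, so the claim reduces to the convexity of the mean.
A trace enters only as a supremum of bounded positive functionals that it dominates after pinching.
-/

open Filter Topology

lemma convexOn_of_forall_lineMap {E : Type*} [AddCommGroup E] [Module ℝ E] {s : Set E} {f : E → ℝ}
    (hs : Convex ℝ s)
    (h : ∀ x ∈ s, ∀ y ∈ s, ConvexOn ℝ (Icc 0 1) fun t : ℝ => f (AffineMap.lineMap x y t)) :
    ConvexOn ℝ s f := by
  refine ⟨hs, fun x hx y hy a b ha hb hab => ?_⟩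
  have := (h x hx y hy).2 (left_mem_Icc.2 zero_le_one) (right_mem_Icc.2 zero_le_one) ha hb hab
  simpa [AffineMap.lineMap_apply_module, eq_sub_of_add_eq hab] using this

lemma convexOn_of_interior {E : Type*} [AddCommGroup E] [Module ℝ E] [TopologicalSpace E]
    [IsTopologicalAddGroup E] [ContinuousSMul ℝ E] {s : Set E} {f : E → ℝ} (hs : Convex ℝ s)
    (hne : (interior s).Nonempty) (hf : ContinuousOn f s) (h : ConvexOn ℝ (interior s) f) :
    ConvexOn ℝ s f := by
  refine ⟨hs, fun x hx y hy a b ha hb hab => ?_⟩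
  have hcont : ContinuousOn (fun p : E × E => f (a • p.1 + b • p.2)) (s ×ˢ s) :=
    hf.comp (by fun_prop) fun p hp => hs hp.1 hp.2 ha hb hab
  have hcont' : ContinuousOn (fun p : E × E => a • f p.1 + b • f p.2) (s ×ˢ s) :=
    ((hf.comp continuousOn_fst fun p hp => hp.1).const_smul a).add
      ((hf.comp continuousOn_snd fun p hp => hp.2).const_smul b)
  have hsub : interior s ×ˢ interior s ⊆ s ×ˢ s := prod_mono interior_subset interior_subset
  refine ContinuousWithinAt.closure_le (x := (x, y)) (s := interior s ×ˢ interior s) ?_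
    ((hcont _ ⟨hx, hy⟩).mono hsub) ((hcont' _ ⟨hx, hy⟩).mono hsub)
    fun p hp => h.2 hp.1 hp.2 ha hb hab
  rw [closure_prod_eq, hs.closure_interior_eq_closure_of_nonempty_interior hne]
  exact ⟨subset_closure hx, subset_closure hy⟩

lemma mapsTo_interior_image_of_strictMonoOn {f : ℝ → ℝ} {s : Set ℝ} (hf : StrictMonoOn f s)
    (hs : (f '' s).OrdConnected) : MapsTo f (interior s) (interior (f '' s)) := by
  intro x hx
  obtain ⟨a, b, ⟨hax, hxb⟩, hsub⟩ :=
    mem_nhds_iff_exists_Ioo_subset.1 (mem_interior_iff_mem_nhds.1 hx)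
  obtain ⟨c, hac, hcx⟩ := exists_between hax
  obtain ⟨d, hxd, hdb⟩ := exists_between hxb
  have hc : c ∈ s := hsub ⟨hac, hcx.trans hxb⟩
  have hd : d ∈ s := hsub ⟨hax.trans hxd, hdb⟩
  have hxs := interior_subset hx
  exact mem_interior_iff_mem_nhds.2 (mem_of_superset (Icc_mem_nhds (hf hc hxs hcx) (hf hxs hd hxd))
    (hs.out (mem_image_of_mem f hc) (mem_image_of_mem f hd)))

namespace IsEllPair

variable {e l : ℝ → ℝ} {I : Set ℝ}

lemma invOn (h : IsEllPair e l I) : InvOn l e I (e '' I) :=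
  ⟨h.leftInv, h.leftInv.rightInvOn_image⟩

lemma mapsTo_inv (h : IsEllPair e l I) : MapsTo l (e '' I) I :=
  h.leftInv.mapsTo (surjOn_image e I)

lemma strictMonoOn_inv (h : IsEllPair e l I) : StrictMonoOn l (e '' I) := by
  rintro _ ⟨s, hs, rfl⟩ _ ⟨r, hr, rfl⟩ hsr
  rw [h.leftInv hs, h.leftInv hr]
  exact (h.strictMono.lt_iff_lt hs hr).1 hsr

lemma convex_image (h : IsEllPair e l I) : Convex ℝ (e '' I) :=
  ((h.convex.1.isPreconnected).image e h.continuous).ordConnected.convex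

lemma interior_image (h : IsEllPair e l I) : interior (e '' I) = e '' interior I := by
  refine Subset.antisymm (fun t ht => ?_)
    (mapsTo_interior_image_of_strictMonoOn h.strictMono h.convex_image.ordConnected).image_subset
  have hl : l '' (e '' I) = I := h.leftInv.image_image
  refine ⟨l t, ?_, h.invOn.2 (interior_subset ht)⟩
  have := mapsTo_interior_image_of_strictMonoOn h.strictMonoOn_inv
    (by rw [hl]; exact h.convex.1.ordConnected) ht
  rwa [hl] at this

lemma continuousOn_inv (h : IsEllPair e l I) : ContinuousOn l (e '' I) := by
  have := h.convex.1.ordConnected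
  have := h.convex_image.ordConnected
  have hl : (e '' I).domRestrict l = fun t => ((h.strictMono.orderIso e I).symm t : ℝ) := by
    ext t
    obtain ⟨s, rfl⟩ := (h.strictMono.orderIso e I).surjective t
    rw [OrderIso.symm_apply_apply]
    exact h.leftInv s.2
  rw [continuousOn_iff_continuous_domRestrict, hl]
  exact continuous_subtype_val.comp (h.strictMono.orderIso e I).symm.continuous

lemma hasStrictDerivAt (h : IsEllPair e l I) {s : ℝ} (hs : s ∈ interior I) :
    HasStrictDerivAt e (deriv e s) s :=
  (h.contDiff.contDiffAt (isOpen_interior.mem_nhds hs)).hasStrictDerivAt (by norm_num)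

lemma hasDerivAt_deriv (h : IsEllPair e l I) {s : ℝ} (hs : s ∈ interior I) :
    HasDerivAt (deriv e) (deriv (deriv e) s) s :=
  (((h.contDiff.deriv_of_isOpen (m := 1) isOpen_interior (by norm_num)).contDiffAt
    (isOpen_interior.mem_nhds hs)).differentiableAt (by norm_num)).hasDerivAt

lemma deriv_pos (h : IsEllPair e l I) {s : ℝ} (hs : s ∈ interior I) : 0 < deriv e s := by
  have hnonneg : ∀ r ∈ interior I, 0 ≤ deriv e r := fun r hr => by
    rw [← derivWithin_of_isOpen isOpen_interior hr]
    exact (h.strictMono.monotoneOn.mono interior_subset).derivWithin_nonneg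
  have hstrict : StrictMonoOn (deriv e) (interior I) :=
    strictMonoOn_of_deriv_pos h.convex.1.interior
      (fun r hr => (h.hasDerivAt_deriv hr).continuousAt.continuousWithinAt)
      fun r hr => h.deriv2_pos r (interior_subset hr)
  obtain ⟨r, hrs, hr⟩ : ∃ r < s, r ∈ interior I := by
    obtain ⟨a, has, hsub⟩ := exists_Ioc_subset_of_mem_nhds (isOpen_interior.mem_nhds hs)
      ⟨s - 1, sub_one_lt s⟩
    obtain ⟨r, har, hrs⟩ := exists_between has
    exact ⟨r, hrs, hsub ⟨har, hrs.le⟩⟩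
  exact (hnonneg r hr).trans_lt (hstrict hr hs hrs)

lemma hasDerivAt_inv (h : IsEllPair e l I) {s : ℝ} (hs : s ∈ interior I) :
    HasDerivAt l (deriv e s)⁻¹ (e s) := by
  refine ((h.hasStrictDerivAt hs).to_local_left_inverse (h.deriv_pos hs).ne' ?_).hasDerivAt
  filter_upwards [isOpen_interior.mem_nhds hs] with r hr
  exact h.leftInv (interior_subset hr)

lemma hasDerivAt_deriv_inv (h : IsEllPair e l I) {s : ℝ} (hs : s ∈ interior I) :
    HasDerivAt (deriv l) (-deriv (deriv e) s / deriv e s ^ 3) (e s) := by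
  have hls : l (e s) = s := h.leftInv (interior_subset hs)
  have hl : deriv l =ᶠ[𝓝 (e s)] fun t => (deriv e (l t))⁻¹ := by
    filter_upwards [isOpen_interior.mem_nhds (h.interior_image ▸ mem_image_of_mem e hs)] with t ht
    obtain ⟨r, hr, rfl⟩ := h.interior_image ▸ ht
    rw [(h.hasDerivAt_inv hr).deriv, h.leftInv (interior_subset hr)]
  have hcomp : HasDerivAt (fun t => deriv e (l t)) (deriv (deriv e) s * (deriv e s)⁻¹) (e s) :=
    (hls.symm ▸ h.hasDerivAt_deriv hs : HasDerivAt (deriv e) _ (l (e s))).comp (e s)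
      (h.hasDerivAt_inv hs)
  have hpos := h.deriv_pos hs
  refine ((hcomp.fun_inv (by rw [hls]; exact hpos.ne')).congr_of_eventuallyEq hl).congr_deriv ?_
  rw [hls]
  field_simp

lemma ellQuot_apply (h : IsEllPair e l I) {s : ℝ} (hs : s ∈ interior I) :
    ellQuot l (e s) = -(deriv e s ^ 2 / deriv (deriv e) s) := by
  have h1 := h.deriv_pos hs
  have h2 := h.deriv2_pos s hs
  rw [ellQuot, (h.hasDerivAt_inv hs).deriv, (h.hasDerivAt_deriv_inv hs).deriv]
  field_simp

/-- Since `(l ∘ E)'' = l''(E) E'² + l'(E) E''` and `l'' < 0`, the hypothesis `hE` says that this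
second derivative is nonnegative. -/
lemma convexOn_inv_comp (h : IsEllPair e l I) {D : Set ℝ} (hD : Convex ℝ D) {E E₁ E₂ : ℝ → ℝ}
    (hmem : ∀ t ∈ D, E t ∈ interior (e '' I)) (hE₁ : ∀ t ∈ D, HasDerivAt E (E₁ t) t)
    (hE₂ : ∀ t ∈ D, HasDerivAt E₁ (E₂ t) t)
    (hE : ∀ t ∈ D, E₁ t ^ 2 ≤ -ellQuot l (E t) * E₂ t) : ConvexOn ℝ D fun t => l (E t) := by
  have hderiv : ∀ t ∈ D, HasDerivAt (fun t => l (E t)) (deriv l (E t) * E₁ t) t := fun t ht => by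
    obtain ⟨s, hs, hst⟩ := h.interior_image ▸ hmem t ht
    have := hst ▸ (h.hasDerivAt_inv hs).differentiableAt.hasDerivAt
    exact this.comp t (hE₁ t ht)
  have hderiv2 : ∀ t ∈ D, HasDerivAt (fun t => deriv l (E t) * E₁ t)
      (deriv (deriv l) (E t) * E₁ t * E₁ t + deriv l (E t) * E₂ t) t := fun t ht => by
    obtain ⟨s, hs, hst⟩ := h.interior_image ▸ hmem t ht
    have := hst ▸ (h.hasDerivAt_deriv_inv hs).differentiableAt.hasDerivAt
    exact (HasDerivAt.comp t this (hE₁ t ht)).mul (hE₂ t ht)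
  refine convexOn_of_hasDerivWithinAt2_nonneg hD
    (fun t ht => (hderiv t ht).continuousAt.continuousWithinAt)
    (fun t ht => (hderiv t (interior_subset ht)).hasDerivWithinAt)
    (fun t ht => (hderiv2 t (interior_subset ht)).hasDerivWithinAt) fun t ht => ?_
  obtain ⟨s, hs, hst⟩ := h.interior_image ▸ hmem t (interior_subset ht)
  have hineq := hE t (interior_subset ht)
  rw [← hst, h.ellQuot_apply hs, neg_neg, div_mul_eq_mul_div, le_div_iff₀ (h.deriv2_pos s hs)]
    at hineq
  rw [← hst, (h.hasDerivAt_inv hs).deriv, (h.hasDerivAt_deriv_inv hs).deriv]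
  have hpos := h.deriv_pos hs
  calc 0 ≤ (deriv e s ^ 2 * E₂ t - E₁ t ^ 2 * deriv (deriv e) s) / deriv e s ^ 3 :=
        div_nonneg (sub_nonneg.2 hineq) (by positivity)
    _ = _ := by field_simp; ring

/-- Cauchy–Schwarz, with `e'(p) d = (e'(p) / √e''(p)) (√e''(p) d)`. -/
lemma sq_sum_deriv_le {ι : Type*} [Fintype ι] (h : IsEllPair e l I) {w p : ι → ℝ}
    (hw : ∀ k, 0 ≤ w k) (hp : ∀ k, p k ∈ interior I) (d : ι → ℝ) :
    (∑ k, w k * (deriv e (p k) * d k)) ^ 2 ≤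
      (-∑ k, w k * ellQuot l (e (p k))) * ∑ k, w k * (deriv (deriv e) (p k) * d k ^ 2) := by
  rw [← Finset.sum_neg_distrib]
  refine Finset.sum_sq_le_sum_mul_sum_of_sq_le_mul _ (fun k _ => ?_) (fun k _ => ?_) fun k _ => ?_
    <;> have hpos := h.deriv2_pos _ (hp k)
  · rw [h.ellQuot_apply (hp k), mul_neg, neg_neg]
    exact mul_nonneg (hw k) (by positivity)
  · exact mul_nonneg (hw k) (by positivity)
  · rw [h.ellQuot_apply (hp k)]
    apply le_of_eq
    field_simp

end IsEllPair

/-- The positive number `W` scales the domain `J` of `l`, and `l' / l''` is homogeneous with respect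
to `W`. By taking `W` to be the total mass of a weight, means for probability weights (`W = 1`) and,
in the homogeneous case, for arbitrary weights are treated together. -/
structure IsEllScaling (l : ℝ → ℝ) (J : Set ℝ) (W : ℝ) : Prop where
  pos : 0 < W
  mul_mem : ∀ t ∈ J, W * t ∈ J
  ellQuot_mul : ∀ t ∈ interior J, ellQuot l (W * t) = W * ellQuot l t

lemma HomogeneousEllQuot.isEllScaling {l : ℝ → ℝ} {J : Set ℝ} (h : HomogeneousEllQuot l J) {W : ℝ}
    (hW : 0 < W) : IsEllScaling l J W :=
  ⟨hW, h.1 W hW, h.2 W hW⟩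

namespace IsEllScaling

lemma one (l : ℝ → ℝ) (J : Set ℝ) : IsEllScaling l J 1 :=
  ⟨one_pos, by simp, by simp⟩

variable {l : ℝ → ℝ} {J : Set ℝ}

lemma mul_mem_interior {W t : ℝ} (h : IsEllScaling l J W) (ht : t ∈ interior J) :
    W * t ∈ interior J :=
  interior_maximal (image_subset_iff.2 fun s hs => h.mul_mem s (interior_subset hs))
    ((Homeomorph.mulLeft₀ W h.pos.ne').isOpenMap _ isOpen_interior) (mem_image_of_mem _ ht)

variable {ι : Type*} [Fintype ι] {w : ι → ℝ}

lemma sum_mul_eq (hW : IsEllScaling l J (∑ k, w k)) (b : ι → ℝ) :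
    ∑ k, w k * b k = (∑ k, w k) * Finset.univ.centerMass w b := by
  simp only [Finset.centerMass, smul_eq_mul, mul_inv_cancel_left₀ hW.pos.ne']

lemma sum_mem (hW : IsEllScaling l J (∑ k, w k)) (hJ : Convex ℝ J) (hw : ∀ k, 0 ≤ w k) {b : ι → ℝ}
    (hb : ∀ k, b k ∈ J) : ∑ k, w k * b k ∈ J := by
  rw [hW.sum_mul_eq]
  exact hW.mul_mem _ (hJ.centerMass_mem (fun k _ => hw k) hW.pos fun k _ => hb k)

lemma sum_mem_interior (hW : IsEllScaling l J (∑ k, w k)) (hJ : Convex ℝ J) (hw : ∀ k, 0 ≤ w k)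
    {b : ι → ℝ} (hb : ∀ k, b k ∈ interior J) : ∑ k, w k * b k ∈ interior J := by
  rw [hW.sum_mul_eq]
  exact hW.mul_mem_interior (hJ.interior.centerMass_mem (fun k _ => hw k) hW.pos fun k _ => hb k)

lemma ellQuot_sum_le (hW : IsEllScaling l J (∑ k, w k)) (hl : ConvexOn ℝ (interior J) (ellQuot l))
    (hw : ∀ k, 0 ≤ w k) {b : ι → ℝ} (hb : ∀ k, b k ∈ interior J) :
    ellQuot l (∑ k, w k * b k) ≤ ∑ k, w k * ellQuot l (b k) := by
  rw [hW.sum_mul_eq, hW.sum_mul_eq fun k => ellQuot l (b k), hW.ellQuot_mul _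
    (hl.1.centerMass_mem (fun k _ => hw k) hW.pos fun k _ => hb k)]
  exact mul_le_mul_of_nonneg_left
    (hl.map_centerMass_le (fun k _ => hw k) hW.pos fun k _ => hb k) hW.pos.le

end IsEllScaling

namespace IsEllPair

variable {e l : ℝ → ℝ} {I : Set ℝ} {ι : Type*} [Fintype ι] {w : ι → ℝ}

lemma convexOn_mean_interior (h : IsEllPair e l I) (hl : ConvexOn ℝ (interior (e '' I)) (ellQuot l))
    (hW : IsEllScaling l (e '' I) (∑ k, w k)) (hw : ∀ k, 0 ≤ w k) :
    ConvexOn ℝ (univ.pi fun _ : ι => interior I) fun u => l (∑ k, w k * e (u k)) := by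
  have hconv : Convex ℝ (univ.pi fun _ : ι => interior I) :=
    convex_pi fun _ _ => h.convex.1.interior
  refine convexOn_of_forall_lineMap hconv fun u hu v hv => ?_
  let p : ι → ℝ → ℝ := fun k => AffineMap.lineMap (u k) (v k)
  have hp : ∀ t ∈ Icc (0 : ℝ) 1, ∀ k, p k t ∈ interior I := fun t ht k =>
    h.convex.1.interior.lineMap_mem (hu k trivial) (hv k trivial) ht
  have hep : ∀ t ∈ Icc (0 : ℝ) 1, ∀ k, e (p k t) ∈ interior (e '' I) := fun t ht k =>
    h.interior_image ▸ mem_image_of_mem e (hp t ht k)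
  have hp' : ∀ k t, HasDerivAt (p k) (v k - u k) t := fun k t => AffineMap.hasDerivAt_lineMap
  have hE₁ : ∀ t ∈ Icc (0 : ℝ) 1, HasDerivAt (fun t => ∑ k, w k * e (p k t))
      (∑ k, w k * (deriv e (p k t) * (v k - u k))) t := fun t ht =>
    HasDerivAt.fun_sum fun k _ =>
      ((h.hasStrictDerivAt (hp t ht k)).hasDerivAt.comp t (hp' k t)).const_mul (w k)
  have hE₂ : ∀ t ∈ Icc (0 : ℝ) 1,
      HasDerivAt (fun t => ∑ k, w k * (deriv e (p k t) * (v k - u k)))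
        (∑ k, w k * (deriv (deriv e) (p k t) * (v k - u k) ^ 2)) t := fun t ht => by
    refine HasDerivAt.fun_sum fun k _ => HasDerivAt.const_mul (w k) ?_
    rw [pow_two, ← mul_assoc]
    exact ((h.hasDerivAt_deriv (hp t ht k)).comp t (hp' k t)).mul_const _
  simp only [AffineMap.pi_lineMap_apply]
  refine h.convexOn_inv_comp (convex_Icc 0 1)
    (fun t ht => hW.sum_mem_interior h.convex_image hw (hep t ht)) hE₁ hE₂ fun t ht =>
    (h.sq_sum_deriv_le hw (hp t ht) _).trans (mul_le_mul_of_nonneg_right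
      (neg_le_neg (hW.ellQuot_sum_le hl hw (hep t ht))) (Finset.sum_nonneg fun k _ => ?_))
  have := h.deriv2_pos _ (hp t ht k)
  exact mul_nonneg (hw k) (by positivity)

lemma convexOn_mean (h : IsEllPair e l I) (hl : ConvexOn ℝ (interior (e '' I)) (ellQuot l))
    (hW : IsEllScaling l (e '' I) (∑ k, w k)) (hw : ∀ k, 0 ≤ w k) :
    ConvexOn ℝ (univ.pi fun _ : ι => I) fun u => l (∑ k, w k * e (u k)) := by
  have hconv : Convex ℝ (univ.pi fun _ : ι => I) := convex_pi fun _ _ => h.convex.1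
  have hint : interior (univ.pi fun _ : ι => I) = univ.pi fun _ => interior I :=
    interior_pi_set finite_univ
  rcases I.subsingleton_or_nontrivial with hI | hI
  · refine ⟨hconv, fun u hu v hv a b _ _ hab => ?_⟩
    obtain rfl := subsingleton_univ_pi (fun _ => hI) hu hv
    rw [Convex.combo_self hab, Convex.combo_self hab]
  · refine convexOn_of_interior hconv ?_ ?_ (hint ▸ h.convexOn_mean_interior hl hW hw)
    · rw [hint, univ_pi_nonempty_iff]
      exact fun _ => h.convex.1.nontrivial_iff_nonempty_interior.1 hI
    · refine h.continuousOn_inv.comp (continuousOn_finsetSum _ fun k _ => ?_) fun u hu =>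
        hW.sum_mem h.convex_image hw fun k => mem_image_of_mem e (hu k trivial)
      exact continuousOn_const.mul
        (h.continuous.comp (continuous_apply k).continuousOn fun u hu => hu k trivial)

lemma sum_mul_le (h : IsEllPair e l I) (hl : ConvexOn ℝ (interior (e '' I)) (ellQuot l))
    (hW : IsEllScaling l (e '' I) (∑ k, w k)) (hw : ∀ k, 0 ≤ w k) {u v : ι → ℝ}
    (hu : ∀ k, u k ∈ I) (hv : ∀ k, v k ∈ I) {a b r s : ℝ} (ha : 0 ≤ a) (hb : 0 ≤ b)
    (hab : a + b = 1) (hr : r ∈ I) (hs : s ∈ I) (hur : ∑ k, w k * e (u k) ≤ e r)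
    (hvs : ∑ k, w k * e (v k) ≤ e s) :
    ∑ k, w k * e (a * u k + b * v k) ≤ e (a * r + b * s) := by
  have hmem : ∀ {p : ι → ℝ}, (∀ k, p k ∈ I) → ∑ k, w k * e (p k) ∈ e '' I := fun hp =>
    hW.sum_mem h.convex_image hw fun k => mem_image_of_mem e (hp k)
  have hle : ∀ {p : ι → ℝ} {t : ℝ}, (∀ k, p k ∈ I) → t ∈ I → ∑ k, w k * e (p k) ≤ e t →
      l (∑ k, w k * e (p k)) ≤ t := fun hp ht hpt =>
    (h.strictMonoOn_inv.monotoneOn (hmem hp) (mem_image_of_mem e ht) hpt).trans_eq (h.leftInv ht)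
  have hmem' := hmem fun k => h.convex.1 (hu k) (hv k) ha hb hab
  calc ∑ k, w k * e (a * u k + b * v k) = e (l (∑ k, w k * e (a * u k + b * v k))) :=
        (h.invOn.2 hmem').symm
    _ ≤ e (a * r + b * s) := by
        refine h.strictMono.monotoneOn (h.mapsTo_inv hmem') (h.convex.1 hr hs ha hb hab) ?_
        exact ((h.convexOn_mean hl hW hw).2 (fun k _ => hu k) (fun k _ => hv k) ha hb hab).trans
          (add_le_add (mul_le_mul_of_nonneg_left (hle hu hr hur) ha)
            (mul_le_mul_of_nonneg_left (hle hv hs hvs) hb))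

end IsEllPair

section EllConvex

variable {E : Type*} [AddCommGroup E] [Module ℝ E] {e l : ℝ → ℝ} {I : Set ℝ} {S : Set E}

lemma EllConvexOn.convexOn {F : E → ℝ} (hF : EllConvexOn e I S F) (he : ConvexOn ℝ I e)
    (hmono : MonotoneOn e I) : ConvexOn ℝ S F := by
  obtain ⟨g, hg, hgI, hFg⟩ := hF
  refine ⟨hg.1, fun x hx y hy a b ha hb hab => ?_⟩
  rw [hFg (hg.1 hx hy ha hb hab), hFg hx, hFg hy]
  calc e (g (a • x + b • y)) ≤ e (a • g x + b • g y) :=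
        hmono (hgI (hg.1 hx hy ha hb hab)) (he.1 (hgI hx) (hgI hy) ha hb hab)
          (hg.2 hx hy ha hb hab)
    _ ≤ a • e (g x) + b • e (g y) := he.2 (hgI hx) (hgI hy) ha hb hab

lemma IsEllPair.ellConvexOn_of_le (h : IsEllPair e l I) (hS : Convex ℝ S) {F : E → ℝ}
    (hFI : MapsTo F S (e '' I))
    (hF : ∀ x ∈ S, ∀ y ∈ S, ∀ a b : ℝ, 0 ≤ a → 0 ≤ b → a + b = 1 →
      F (a • x + b • y) ≤ e (a * l (F x) + b * l (F y))) : EllConvexOn e I S F := by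
  refine ⟨fun x => l (F x), ⟨hS, fun x hx y hy a b ha hb hab => ?_⟩,
    fun x hx => h.mapsTo_inv (hFI hx), fun x hx => (h.invOn.2 (hFI hx)).symm⟩
  have hmem : a * l (F x) + b * l (F y) ∈ I :=
    h.convex.1 (h.mapsTo_inv (hFI hx)) (h.mapsTo_inv (hFI hy)) ha hb hab
  exact (h.strictMonoOn_inv.monotoneOn (hFI (hS hx hy ha hb hab)) (mem_image_of_mem e hmem)
    (hF x hx y hy a b ha hb hab)).trans_eq (h.leftInv hmem)

lemma IsEllPair.extEllConvexOn_of_le (h : IsEllPair e l I) (hS : Convex ℝ S) {F : E → ℝ≥0∞}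
    (hFI : ∀ x ∈ S, F x ≠ ∞ → (F x).toReal ∈ e '' I)
    (hF : ∀ x ∈ S, F x ≠ ∞ → ∀ y ∈ S, F y ≠ ∞ → ∀ a b : ℝ, 0 ≤ a → 0 ≤ b → a + b = 1 →
      F (a • x + b • y) ≤ ENNReal.ofReal (e (a * l (F x).toReal + b * l (F y).toReal))) :
    ExtEllConvexOn e I S F := by
  have hnonneg : Convex ℝ {t ∈ I | 0 ≤ e t} :=
    h.strictMono.monotoneOn.quasiconcaveOn h.convex.1 0
  have hmem : ∀ x ∈ S, F x ≠ ∞ → l (F x).toReal ∈ {t ∈ I | 0 ≤ e t} := fun x hx hx' =>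
    ⟨h.mapsTo_inv (hFI x hx hx'), (h.invOn.2 (hFI x hx hx')).symm ▸ ENNReal.toReal_nonneg⟩
  refine ⟨hS, h.ellConvexOn_of_le ?_ (fun x hx => hFI x hx.1 hx.2) ?_⟩
  · exact fun x hx y hy a b ha hb hab => ⟨hS hx.1 hy.1 ha hb hab, ne_top_of_le_ne_top
      ENNReal.ofReal_ne_top (hF x hx.1 hx.2 y hy.1 hy.2 a b ha hb hab)⟩
  · exact fun x hx y hy a b ha hb hab => ENNReal.toReal_le_of_le_ofReal
      (hnonneg (hmem x hx.1 hx.2) (hmem y hy.1 hy.2) ha hb hab).2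
      (hF x hx.1 hx.2 y hy.1 hy.2 a b ha hb hab)

end EllConvex

section JointSpectrum

open WeakDual

variable {C : Type*} [CStarAlgebra C] {n : ℕ}

/-- `x₁, …, xₙ` are commuting self-adjoint elements with spectra in `K₁, …, Kₙ`: the tuples to which
the joint functional calculus of functions on `K₁ × ⋯ × Kₙ` applies. -/
structure IsJointTuple (K : Fin n → Set ℝ) (x : Fin n → C) : Prop where
  isSelfAdjoint : ∀ i, IsSelfAdjoint (x i)
  commute : ∀ i j, Commute (x i) (x j)
  spectrum_subset : ∀ i, spectrum ℝ (x i) ⊆ K i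

/-- The joint spectrum of a tuple of commuting self-adjoint elements: the set of its values under
the characters of the C⋆-algebra it generates. (The real parts are taken only to land in `ℝⁿ`.) -/
def jointSpectrum (x : Fin n → C) : Set (Fin n → ℝ) :=
  range fun (χ : characterSpace ℂ (jointAlgebra x)) i => (χ ⟨x i, mem_jointAlgebra x i⟩).re

/-- A coordinate function on a subset of `ℝⁿ`. -/
def coord (Q : Set (Fin n → ℝ)) (i : Fin n) : C(Q, ℝ) where
  toFun q := q.1 i
  continuous_toFun := (continuous_apply i).comp continuous_subtype_val

@[simp] lemma coord_apply (Q : Set (Fin n → ℝ)) (i : Fin n) (q : Q) : coord Q i q = q.1 i := rfl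

/-- The inverse of the Gelfand transform, restricted to real functions. -/
noncomputable def realGelfandInv (C : Type*) [CommCStarAlgebra C] :
    C(characterSpace ℂ C, ℝ) →⋆ₐ[ℝ] C where
  __ := ((gelfandStarTransform C).symm : C(characterSpace ℂ C, ℂ) →ₐ[ℂ] C).restrictScalars ℝ |>.comp
    (ContinuousMap.realToRCLikeStarAlgHom (characterSpace ℂ C) ℂ).toAlgHom
  map_star' F := by
    change (gelfandStarTransform C).symm _ = star ((gelfandStarTransform C).symm _)
    rw [← map_star]
    exact congrArg _ (map_star (ContinuousMap.realToRCLikeStarAlgHom _ ℂ) F)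

lemma apply_realGelfandInv {C : Type*} [CommCStarAlgebra C] (χ : characterSpace ℂ C)
    (F : C(characterSpace ℂ C, ℝ)) : χ (realGelfandInv C F) = (F χ : ℂ) :=
  DFunLike.congr_fun ((gelfandStarTransform C).apply_symm_apply (F.realToRCLike ℂ)) χ

namespace IsJointTuple

variable {K : Fin n → Set ℝ} {x : Fin n → C}

/-- The C⋆-algebra generated by a tuple of commuting self-adjoint elements is commutative. -/
noncomputable abbrev commCStarAlgebra (hx : IsJointTuple K x) :
    CommCStarAlgebra (jointAlgebra x) :=
  have : IsMulCommutative (StarAlgebra.adjoin ℂ (range x)) :=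
    StarAlgebra.isMulCommutative_adjoin ℂ
      (by rintro _ ⟨i, rfl⟩ _ ⟨j, rfl⟩; exact hx.commute i j)
      (by rintro _ ⟨i, rfl⟩ _ ⟨j, rfl⟩; rw [(hx.isSelfAdjoint j).star_eq]; exact hx.commute i j)
  { StarSubalgebra.cstarAlgebra (jointAlgebra x)
      (h_closed := StarSubalgebra.isClosed_topologicalClosure _) with
    mul_comm := (StarSubalgebra.commRingTopologicalClosure (StarAlgebra.adjoin ℂ (range x))
      (fun a b => mul_comm' a b)).mul_comm }

lemma ofReal_re_apply (hx : IsJointTuple K x) (χ : characterSpace ℂ (jointAlgebra x)) (i : Fin n) :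
    ((χ ⟨x i, mem_jointAlgebra x i⟩).re : ℂ) = χ ⟨x i, mem_jointAlgebra x i⟩ := by
  let := hx.commCStarAlgebra
  have hsa : IsSelfAdjoint (⟨x i, mem_jointAlgebra x i⟩ : jointAlgebra x) :=
    Subtype.ext (hx.isSelfAdjoint i)
  exact Complex.conj_eq_iff_re.1 (hsa.map χ)

lemma continuous_re_apply (hx : IsJointTuple K x) :
    Continuous fun (χ : characterSpace ℂ (jointAlgebra x)) i =>
      (χ ⟨x i, mem_jointAlgebra x i⟩).re :=
  letI := hx.commCStarAlgebra
  continuous_pi fun i => Complex.continuous_re.comp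
    (map_continuous (gelfandTransform ℂ (jointAlgebra x) ⟨x i, mem_jointAlgebra x i⟩))

lemma isCompact_jointSpectrum (hx : IsJointTuple K x) : IsCompact (jointSpectrum x) :=
  letI := hx.commCStarAlgebra
  isCompact_range hx.continuous_re_apply

lemma nonempty_jointSpectrum [Nontrivial C] (hx : IsJointTuple K x) : (jointSpectrum x).Nonempty :=
  letI := hx.commCStarAlgebra
  range_nonempty _

lemma jointSpectrum_subset (hx : IsJointTuple K x) : jointSpectrum x ⊆ univ.pi K := by
  let := hx.commCStarAlgebra
  rintro _ ⟨χ, rfl⟩ i -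
  have hcl : IsClosed (jointAlgebra x : Set C) := StarSubalgebra.isClosed_topologicalClosure _
  refine hx.spectrum_subset i ((spectrum.algebraMap_mem_iff ℂ).1 ?_)
  have hmem : χ ⟨x i, mem_jointAlgebra x i⟩ ∈
      spectrum ℂ (⟨x i, mem_jointAlgebra x i⟩ : jointAlgebra x) := AlgHom.apply_mem_spectrum χ _
  rwa [StarSubalgebra.spectrum_eq (hS := hcl), ← hx.ofReal_re_apply] at hmem

/-- The character values of a tuple as a map onto its joint spectrum. -/
noncomputable def toJointSpectrum (hx : IsJointTuple K x) :
    C(characterSpace ℂ (jointAlgebra x), jointSpectrum x) where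
  toFun χ := ⟨_, mem_range_self χ⟩
  continuous_toFun := hx.continuous_re_apply.subtype_mk _

/-- The joint functional calculus of a tuple, as a homomorphism from the continuous functions on
its joint spectrum. -/
noncomputable def calculus (hx : IsJointTuple K x) : C(jointSpectrum x, ℝ) →⋆ₐ[ℝ] C :=
  letI := hx.commCStarAlgebra
  let incl : jointAlgebra x →⋆ₐ[ℝ] C :=
    { (jointAlgebra x).subtype.toAlgHom.restrictScalars ℝ with map_star' := fun _ => rfl }
  incl.comp ((realGelfandInv (jointAlgebra x)).comp
    (ContinuousMap.compStarAlgHom' ℝ ℝ hx.toJointSpectrum))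

lemma calculus_coord (hx : IsJointTuple K x) (i : Fin n) :
    hx.calculus (coord (jointSpectrum x) i) = x i := by
  let := hx.commCStarAlgebra
  refine congrArg Subtype.val ((gelfandStarTransform (jointAlgebra x)).injective
    (a₂ := ⟨x i, mem_jointAlgebra x i⟩) (ContinuousMap.ext fun χ => ?_))
  exact (apply_realGelfandInv χ _).trans (hx.ofReal_re_apply χ i)

lemma exists_calculus_eq_jointCfc (hx : IsJointTuple K x) {f : (Fin n → ℝ) → ℝ}
    (hf : ContinuousOn f (univ.pi K)) :
    ∃ F : C(jointSpectrum x, ℝ), (∀ q, F q = f q) ∧ hx.calculus F = jointCfc f x := by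
  let := hx.commCStarAlgebra
  refine ⟨⟨fun q => f q, (hf.mono hx.jointSpectrum_subset).domRestrict⟩, fun _ => rfl,
    (existsUnique_isJointCfc hf hx.isSelfAdjoint hx.commute hx.spectrum_subset).unique
      ⟨Subtype.property _, fun χ => ?_⟩
      (isJointCfc_jointCfc hf hx.isSelfAdjoint hx.commute hx.spectrum_subset)⟩
  exact apply_realGelfandInv (CharacterSpace.equivAlgHom.symm χ.toAlgHom) _

lemma isSelfAdjoint_jointCfc (hx : IsJointTuple K x) {f : (Fin n → ℝ) → ℝ}
    (hf : ContinuousOn f (univ.pi K)) : IsSelfAdjoint (jointCfc f x) := by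
  obtain ⟨F, -, hF⟩ := hx.exists_calculus_eq_jointCfc hf
  exact hF ▸ (show IsSelfAdjoint F from rfl).map hx.calculus

end IsJointTuple

end JointSpectrum

section PositiveFunctional

open MeasureTheory

lemma exists_measure_integral_eq {X : Type*} [TopologicalSpace X] [CompactSpace X] [T2Space X]
    [MeasurableSpace X] [BorelSpace X] (L : C(X, ℝ) →ₚ[ℝ] ℝ) :
    ∃ μ : Measure X, IsFiniteMeasure μ ∧ ∀ F, L F = ∫ x, F x ∂μ := by
  let Λ : CompactlySupportedContinuousMap X ℝ →ₚ[ℝ] ℝ :=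
    { toFun F := L (CompactlySupportedContinuousMap.continuousMapEquiv.symm F)
      map_add' _ _ := map_add L _ _
      map_smul' _ _ := map_smul L _ _
      monotone' _ _ h := OrderHomClass.mono L h }
  exact ⟨RealRMK.rieszMeasure Λ, inferInstance, fun F =>
    (RealRMK.integral_rieszMeasure Λ (CompactlySupportedContinuousMap.continuousMapEquiv F)).symm⟩

variable {n : ℕ} {f : (Fin n → ℝ) → ℝ} {Q : Set (Fin n → ℝ)}

lemma exists_Icc_of_isCompact {K : Fin n → Set ℝ} (hK : ∀ i, (K i).OrdConnected) (hQ : IsCompact Q)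
    (hne : Q.Nonempty) (hQK : Q ⊆ univ.pi K) :
    ∃ a b : Fin n → ℝ, Q ⊆ Icc a b ∧ Icc a b ⊆ univ.pi K := by
  choose a haQ ha using fun i => hQ.exists_isMinOn hne (continuous_apply i).continuousOn
  choose b hbQ hb using fun i => hQ.exists_isMaxOn hne (continuous_apply i).continuousOn
  exact ⟨fun i => a i i, fun i => b i i, fun q hq => ⟨fun i => ha i hq, fun i => hb i hq⟩,
    fun q hq i _ => (hK i).out (hQK (haQ i) i trivial) (hQK (hbQ i) i trivial) ⟨hq.1 i, hq.2 i⟩⟩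

lemma exists_barycenter_le [CompactSpace Q] {K : Fin n → Set ℝ} (hK : ∀ i, (K i).OrdConnected)
    (hf : ContinuousOn f (univ.pi K)) (hfc : ConvexOn ℝ (univ.pi K) f)
    (hne : Q.Nonempty) (hQK : Q ⊆ univ.pi K) (L : C(Q, ℝ) →ₚ[ℝ] ℝ) {F : C(Q, ℝ)}
    (hF : ∀ q, F q = f q) :
    ∃ q ∈ univ.pi K, (∀ i, L (coord Q i) = L 1 * q i) ∧ L 1 * f q ≤ L F := by
  obtain ⟨μ, _, hμ⟩ := exists_measure_integral_eq L
  have hcoord : Integrable (fun q : Q => q.1) μ := .of_eval fun i =>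
    (coord Q i).continuous.integrable_of_hasCompactSupport (.of_compactSpace _)
  have hfQ : Integrable (fun q : Q => f q.1) μ :=
    (F.continuous.integrable_of_hasCompactSupport (.of_compactSpace _)).congr (.of_forall hF)
  have hmass : L 1 = μ.real univ := by simp [hμ]
  rcases eq_zero_or_neZero μ with rfl | _
  · obtain ⟨q, hq⟩ := hne
    exact ⟨q, hQK hq, by simp [hμ], by simp [hμ]⟩
  · obtain ⟨a, b, hQab, habK⟩ :=
      exists_Icc_of_isCompact hK (isCompact_iff_compactSpace.2 ‹_›) hne hQK
    have hab : ∀ᵐ q : Q ∂μ, q.1 ∈ Icc a b := .of_forall fun q => hQab q.2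
    have hfab := hfc.subset habK (convex_Icc a b)
    refine ⟨⨍ q : Q, q.1 ∂μ, habK ((convex_Icc a b).average_mem isClosed_Icc hab hcoord),
      fun i => ?_, ?_⟩
    · rw [hmass, ← smul_eq_mul, ← Pi.smul_apply, measure_smul_average, eval_integral hcoord.eval,
        hμ]
      rfl
    · calc L 1 * f (⨍ q : Q, q.1 ∂μ) ≤ L 1 * ⨍ q : Q, f q ∂μ :=
            mul_le_mul_of_nonneg_left
              (hfab.map_average_le (hf.mono habK) isClosed_Icc hab hcoord hfQ)
              (hmass ▸ measureReal_nonneg)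
        _ = ∫ q : Q, f q ∂μ := by rw [hmass, ← smul_eq_mul, measure_smul_average]
        _ = L F := by simp_rw [hμ, hF]

lemma exists_finite_partition {X : Type*} [TopologicalSpace X] [CompactSpace X] [T2Space X]
    {U : X → Set X} (hU : ∀ x, U x ∈ 𝓝 x) :
    ∃ (m : ℕ) (c : Fin m → X) (h : Fin m → C(X, ℝ)), (∀ k, 0 ≤ h k) ∧ ∑ k, h k = 1 ∧
      ∀ k x, h k x ≠ 0 → x ∈ U (c k) := by
  obtain ⟨t, -, ht⟩ := isCompact_univ.elim_nhds_subcover (fun x => interior (U x))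
    fun x _ => interior_mem_nhds.2 (hU x)
  obtain ⟨m, ⟨φ⟩⟩ := Finite.exists_equiv_fin t
  obtain ⟨h, hh⟩ := PartitionOfUnity.exists_isSubordinate_of_locallyFinite (X := X) isClosed_univ
    (fun k => interior (U (φ.symm k))) (fun k => isOpen_interior) (locallyFinite_of_finite _)
    (ht.trans (iUnion₂_subset fun x hx => subset_iUnion_of_subset (φ ⟨x, hx⟩) (by simp)))
  refine ⟨m, fun k => φ.symm k, h, h.nonneg, ContinuousMap.ext fun x => ?_, fun k x hx =>
    interior_subset (hh k (subset_closure hx))⟩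
  simpa [ContinuousMap.sum_apply, finsum_eq_sum_of_fintype] using h.sum_eq_one (mem_univ x)

lemma apply_mul_le {X : Type*} [TopologicalSpace X] (L : C(X, ℝ) →ₚ[ℝ] ℝ) {h c : C(X, ℝ)} {r : ℝ}
    (hh : 0 ≤ h) (hc : ∀ x, h x ≠ 0 → c x ≤ r) : L (h * c) ≤ L h * r := by
  have hle : h * c ≤ r • h := fun x => by
    rcases eq_or_ne (h x) 0 with hx | hx
    · simp [hx]
    · simpa [mul_comm] using mul_le_mul_of_nonneg_left (hc x hx) (hh x)
  calc L (h * c) ≤ L (r • h) := OrderHomClass.mono L hle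
    _ = L h * r := by rw [map_smul, smul_eq_mul, mul_comm]

lemma le_apply_mul {X : Type*} [TopologicalSpace X] (L : C(X, ℝ) →ₚ[ℝ] ℝ) {h c : C(X, ℝ)} {r : ℝ}
    (hh : 0 ≤ h) (hc : ∀ x, h x ≠ 0 → r ≤ c x) : L h * r ≤ L (h * c) := by
  have := apply_mul_le L (c := -c) hh fun x hx => neg_le_neg (hc x hx)
  rwa [mul_neg, map_neg, mul_neg, neg_le_neg_iff] at this

/-- On a fine partition of unity Jensen's inequality is reversed up to any given error. -/
lemma exists_partition_apply_mul_le {D : Set (Fin n → ℝ)} [CompactSpace Q] (hQD : Q ⊆ D)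
    (hf : ContinuousOn f D) {F : C(Q, ℝ)} (hF : ∀ q, F q = f q) {η : ℝ} (hη : 0 < η) :
    ∃ (m : ℕ) (h : Fin m → C(Q, ℝ)), (∀ k, 0 ≤ h k) ∧ ∑ k, h k = 1 ∧
      ∀ (L : C(Q, ℝ) →ₚ[ℝ] ℝ) (k : Fin m), ∀ q ∈ D,
        (∀ i, L (h k * coord Q i) = L (h k) * q i) → L (h k * F) ≤ L (h k) * (f q + η) := by
  have hmod : ∀ c : Q, ∃ δ > 0, ∀ q ∈ D, dist q c.1 ≤ δ → dist (f q) (f c) ≤ η / 2 := fun c => by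
    obtain ⟨δ, hδ, h⟩ := ((nhdsWithin_hasBasis Metric.nhds_basis_closedBall D).tendsto_iff
      Metric.nhds_basis_closedBall).1 (hf c (hQD c.2)) (η / 2) (half_pos hη)
    exact ⟨δ, hδ, fun q hq hqc => h q ⟨hqc, hq⟩⟩
  choose δ hδ hfδ using hmod
  obtain ⟨m, c, h, hh, hsum, hsupp⟩ :=
    exists_finite_partition fun c : Q => Metric.closedBall_mem_nhds c (hδ c)
  refine ⟨m, h, hh, hsum, fun L k q hq hbary => ?_⟩
  have hFc : L (h k * F) ≤ L (h k) * (f (c k) + η / 2) := apply_mul_le L (hh k) fun x hx => by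
    rw [hF]
    have := hfδ (c k) x (hQD x.2) (hsupp k x hx)
    linarith [(abs_le.1 this).2]
  have hLh : 0 ≤ L (h k) := map_nonneg L (hh k)
  rcases hLh.eq_or_lt with h0 | h0
  · rwa [← h0, zero_mul] at hFc ⊢
  have hqc : dist q (c k).1 ≤ δ (c k) := by
    rw [dist_pi_le_iff (hδ _).le]
    intro i
    have hx : ∀ x, h k x ≠ 0 → dist (x.1 i) ((c k).1 i) ≤ δ (c k) := fun x hx =>
      (dist_le_pi_dist _ _ i).trans (hsupp k x hx)
    have h1 := apply_mul_le L (c := coord Q i) (r := (c k).1 i + δ (c k)) (hh k) fun x hxk => by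
      linarith [coord_apply Q i x, (abs_le.1 (hx x hxk)).2]
    have h2 := le_apply_mul L (c := coord Q i) (r := (c k).1 i - δ (c k)) (hh k) fun x hxk => by
      linarith [coord_apply Q i x, (abs_le.1 (hx x hxk)).1]
    rw [hbary, mul_le_mul_iff_right₀ h0] at h1 h2
    exact abs_le.2 ⟨by linarith, by linarith⟩
  have := (abs_le.1 (hfδ (c k) q hq hqc)).1
  exact hFc.trans (mul_le_mul_of_nonneg_left (by linarith) hLh)

end PositiveFunctional

section Pinching

variable {C : Type*} [CStarAlgebra C] [PartialOrder C] [StarOrderedRing C] {n m : ℕ}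
  {K : Fin n → Set ℝ} {f : (Fin n → ℝ) → ℝ} {x y : Fin n → C}

/-- The positive functional `ω (d⋆ · d)`. -/
noncomputable def conjFunctional (ω : C →ₚ[ℝ] ℝ) (d : C) : C →ₚ[ℝ] ℝ :=
  .mk₀ ((ω : C →ₗ[ℝ] ℝ) ∘ₗ LinearMap.mulLeftRight ℝ (star d, d)) fun _ hy =>
    map_nonneg ω (star_left_conjugate_nonneg hy d)

@[simp] lemma conjFunctional_apply (ω : C →ₚ[ℝ] ℝ) (d y : C) :
    conjFunctional ω d y = ω (star d * y * d) := rfl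

/-- A decomposition of the unit into squares of self-adjoint elements, as used to pinch functionals
into the pieces `ω (d k · d k)`. -/
structure IsPinching (d : Fin m → C) : Prop where
  isSelfAdjoint : ∀ k, IsSelfAdjoint (d k)
  sum_mul_self : ∑ k, d k * d k = 1

lemma IsPinching.sum_conjFunctional_one {d : Fin m → C} (hd : IsPinching d) (ω : C →ₚ[ℝ] ℝ) :
    ∑ k, conjFunctional ω (d k) 1 = ω 1 := by
  simp_rw [conjFunctional_apply, mul_one, (hd.isSelfAdjoint _).star_eq, ← map_sum, hd.sum_mul_self]

/-- The pieces of `ω` under every pinching have at `y` values with sum at most `G`. For a trace and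
`y ≥ 0` this holds with `G = ω y`. -/
def PinchedLE (ω : C →ₚ[ℝ] ℝ) (y : C) (G : ℝ) : Prop :=
  ∀ (m : ℕ) (d : Fin m → C), IsPinching d → ∑ k, conjFunctional ω (d k) y ≤ G

lemma PinchedLE.apply_le {ω : C →ₚ[ℝ] ℝ} {y : C} {G : ℝ} (h : PinchedLE ω y G) : ω y ≤ G := by
  simpa using h 1 (fun _ => 1) ⟨fun _ => .one C, by simp⟩

/-- A positive functional as a functional on the continuous functions on a joint spectrum. -/
noncomputable def IsJointTuple.spectralFunctional (hx : IsJointTuple K x) (ω : C →ₚ[ℝ] ℝ) :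
    C(jointSpectrum x, ℝ) →ₚ[ℝ] ℝ :=
  ω.comp (.ofClass hx.calculus)

@[simp] lemma IsJointTuple.spectralFunctional_apply (hx : IsJointTuple K x) (ω : C →ₚ[ℝ] ℝ)
    (F : C(jointSpectrum x, ℝ)) : hx.spectralFunctional ω F = ω (hx.calculus F) := rfl

lemma IsJointTuple.exists_barycenter_le [Nontrivial C] (hx : IsJointTuple K x)
    (hK : ∀ i, (K i).OrdConnected) (hf : ContinuousOn f (univ.pi K))
    (hfc : ConvexOn ℝ (univ.pi K) f) (ω : C →ₚ[ℝ] ℝ) :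
    ∃ q ∈ univ.pi K, (∀ i, ω (x i) = ω 1 * q i) ∧ ω 1 * f q ≤ ω (jointCfc f x) := by
  have := isCompact_iff_compactSpace.1 hx.isCompact_jointSpectrum
  obtain ⟨F, hFf, hF⟩ := hx.exists_calculus_eq_jointCfc hf
  simpa [hF, hx.calculus_coord] using _root_.exists_barycenter_le hK hf hfc
    hx.nonempty_jointSpectrum hx.jointSpectrum_subset (hx.spectralFunctional ω) hFf

lemma IsJointTuple.exists_pinching (hx : IsJointTuple K x) (hf : ContinuousOn f (univ.pi K))
    {η : ℝ} (hη : 0 < η) :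
    ∃ (m : ℕ) (d : Fin m → C), IsPinching d ∧
      ∀ (ω : C →ₚ[ℝ] ℝ) (q : Fin m → Fin n → ℝ), (∀ k, q k ∈ univ.pi K) →
        (∀ k i, conjFunctional ω (d k) (x i) = conjFunctional ω (d k) 1 * q k i) →
        ω (jointCfc f x) ≤ ∑ k, conjFunctional ω (d k) 1 * (f (q k) + η) := by
  have := isCompact_iff_compactSpace.1 hx.isCompact_jointSpectrum
  obtain ⟨F, hFf, hF⟩ := hx.exists_calculus_eq_jointCfc hf
  obtain ⟨m, h, hh, hsum, hle⟩ :=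
    exists_partition_apply_mul_le hx.jointSpectrum_subset hf hFf hη
  let r : Fin m → C(jointSpectrum x, ℝ) := fun k => ⟨fun p => √(h k p), by fun_prop⟩
  have hr : ∀ k, r k * r k = h k := fun k => ContinuousMap.ext fun p => Real.mul_self_sqrt (hh k p)
  have hsa : ∀ k, IsSelfAdjoint (hx.calculus (r k)) := fun k =>
    (show IsSelfAdjoint (r k) from rfl).map hx.calculus
  have hconj : ∀ (ω : C →ₚ[ℝ] ℝ) k G, conjFunctional ω (hx.calculus (r k)) (hx.calculus G) =
      hx.spectralFunctional ω (h k * G) := fun ω k G => by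
    rw [conjFunctional_apply, (hsa k).star_eq, ← map_mul, ← map_mul, mul_right_comm, hr]
    rfl
  refine ⟨m, fun k => hx.calculus (r k), ⟨hsa, ?_⟩, fun ω q hq hbary => ?_⟩
  · simp_rw [← map_mul, hr, ← map_sum, hsum, map_one]
  have hmass : ∀ k, conjFunctional ω (hx.calculus (r k)) 1 = hx.spectralFunctional ω (h k) :=
    fun k => by rw [← map_one hx.calculus, hconj, mul_one]
  simp_rw [hmass, ← hx.calculus_coord, hconj] at hbary ⊢
  calc ω (jointCfc f x) = ∑ k, hx.spectralFunctional ω (h k * F) := by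
        rw [← map_sum, ← Finset.sum_mul, hsum, one_mul, hx.spectralFunctional_apply, hF]
    _ ≤ ∑ k, hx.spectralFunctional ω (h k) * (f (q k) + η) :=
        Finset.sum_le_sum fun k _ => hle _ k (q k) (hq k) (hbary k)

/-- The basic inequality: pinch `ω` along the joint spectrum of `z = a x + b y`, use Jensen's
inequality at `x` and `y` and its approximate converse at `z`, and compare the barycenters. -/
theorem apply_jointCfc_combo_le {e l : ℝ → ℝ} {I : Set ℝ} (hel : IsEllPair e l I)
    (hl : ConvexOn ℝ (interior (e '' I)) (ellQuot l)) (hK : ∀ i, (K i).OrdConnected)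
    (hf : ContinuousOn f (univ.pi K)) (hfl : EllConvexOn e I (univ.pi K) f) {ω : C →ₚ[ℝ] ℝ}
    (hω : IsEllScaling l (e '' I) (ω 1)) {a b r s : ℝ} (ha : 0 ≤ a) (hb : 0 ≤ b) (hab : a + b = 1)
    (hx : IsJointTuple K x) (hy : IsJointTuple K y) (hz : IsJointTuple K (a • x + b • y))
    (hr : r ∈ I) (hs : s ∈ I) (hxr : PinchedLE ω (jointCfc f x) (e r))
    (hys : PinchedLE ω (jointCfc f y) (e s)) :
    ω (jointCfc f (a • x + b • y)) ≤ e (a * r + b * s) := by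
  have : Nontrivial C := ⟨⟨1, 0, fun h => hω.pos.ne' (by rw [h, map_zero])⟩⟩
  have hfc := hfl.convexOn hel.convex hel.strictMono.monotoneOn
  obtain ⟨g, hg, hgI, hfg⟩ := hfl
  refine le_of_forall_pos_le_add fun ε hε => ?_
  obtain ⟨m, d, hd, hle⟩ := hz.exists_pinching hf (div_pos hε hω.pos)
  set w : Fin m → ℝ := fun k => conjFunctional ω (d k) 1
  have hw : ∀ k, 0 ≤ w k := fun k => map_nonneg _ zero_le_one
  have hw1 : ∑ k, w k = ω 1 := hd.sum_conjFunctional_one ω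
  choose u huK hu hfu using fun k => hx.exists_barycenter_le hK hf hfc (conjFunctional ω (d k))
  choose v hvK hv hfv using fun k => hy.exists_barycenter_le hK hf hfc (conjFunctional ω (d k))
  have hqK : ∀ k, a • u k + b • v k ∈ univ.pi K := fun k => hg.1 (huK k) (hvK k) ha hb hab
  have hfq : ∀ k, f (a • u k + b • v k) ≤ e (a * g (u k) + b * g (v k)) := fun k =>
    (hfg (hqK k)).trans_le <| hel.strictMono.monotoneOn (hgI (hqK k))
      (hel.convex.1 (hgI (huK k)) (hgI (hvK k)) ha hb hab) (hg.2 (huK k) (hvK k) ha hb hab)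
  have hur : ∑ k, w k * e (g (u k)) ≤ e r := by
    refine le_trans (Finset.sum_le_sum fun k _ => ?_) (hxr m d hd)
    exact (congrArg _ (hfg (huK k)).symm).trans_le (hfu k)
  have hvs : ∑ k, w k * e (g (v k)) ≤ e s := by
    refine le_trans (Finset.sum_le_sum fun k _ => ?_) (hys m d hd)
    exact (congrArg _ (hfg (hvK k)).symm).trans_le (hfv k)
  calc ω (jointCfc f (a • x + b • y))
      ≤ ∑ k, w k * (f (a • u k + b • v k) + ε / ω 1) := hle ω _ hqK fun k i => by
        simp only [Pi.add_apply, Pi.smul_apply, map_add, map_smul, hu, hv, smul_eq_mul]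
        ring
    _ ≤ ∑ k, w k * (e (a * g (u k) + b * g (v k)) + ε / ω 1) :=
        Finset.sum_le_sum fun k _ => mul_le_mul_of_nonneg_left (by grw [hfq k]) (hw k)
    _ = ∑ k, w k * e (a * g (u k) + b * g (v k)) + ε := by
        simp_rw [mul_add, Finset.sum_add_distrib, ← Finset.sum_mul, hw1,
          mul_div_cancel₀ ε hω.pos.ne']
    _ ≤ e (a * r + b * s) + ε := by
        grw [hel.sum_mul_le hl (hw1 ▸ hω) hw (fun k => hgI (huK k)) (fun k => hgI (hvK k)) ha hb
          hab hr hs hur hvs]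

end Pinching

section Order

variable {C : Type*} [CStarAlgebra C] [PartialOrder C] [StarOrderedRing C] {n : ℕ}
  {K : Fin n → Set ℝ} {f : (Fin n → ℝ) → ℝ} {x : Fin n → C}

lemma apply_one_pos_of_apply_pos {ω : C →ₚ[ℝ] ℝ} {y : C} (hy : IsSelfAdjoint y) (h : 0 < ω y) :
    0 < ω 1 := by
  have hle : ω y ≤ ‖y‖ * ω 1 := by
    rw [← smul_eq_mul, ← map_smul, ← Algebra.algebraMap_eq_smul_one]
    exact OrderHomClass.mono ω hy.le_algebraMap_norm_self
  exact pos_of_mul_pos_right (h.trans_le hle) (norm_nonneg y)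

lemma IsJointTuple.jointCfc_nonneg (hx : IsJointTuple K x) (hf : ContinuousOn f (univ.pi K))
    (hf0 : ∀ p ∈ univ.pi K, 0 ≤ f p) : 0 ≤ jointCfc f x := by
  obtain ⟨F, hFf, hF⟩ := hx.exists_calculus_eq_jointCfc hf
  exact hF ▸ map_nonneg hx.calculus fun q => (hf0 q (hx.jointSpectrum_subset q.2)).trans_eq
    (hFf q).symm

lemma IsJointTuple.exists_apply_jointCfc_eq_mul (hx : IsJointTuple K x)
    (hf : ContinuousOn f (univ.pi K)) {J : Set ℝ} (hJ : J.OrdConnected)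
    (hfJ : MapsTo f (univ.pi K) J) {ω : C →ₚ[ℝ] ℝ} (hω : 0 < ω 1) :
    ∃ t ∈ J, ω (jointCfc f x) = ω 1 * t := by
  have : Nontrivial C := ⟨⟨1, 0, fun h => hω.ne' (by rw [h, map_zero])⟩⟩
  have := isCompact_iff_compactSpace.1 hx.isCompact_jointSpectrum
  have := hx.nonempty_jointSpectrum.to_subtype
  obtain ⟨F, hFf, hF⟩ := hx.exists_calculus_eq_jointCfc hf
  have hFJ : ∀ q, F q ∈ J := fun q => hFf q ▸ hfJ (hx.jointSpectrum_subset q.2)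
  have hconst : ∀ r, hx.spectralFunctional ω (algebraMap ℝ _ r) = r * ω 1 := fun r => by
    rw [Algebra.algebraMap_eq_smul_one, map_smul, hx.spectralFunctional_apply, map_one, smul_eq_mul]
  obtain ⟨p, -, hp⟩ := isCompact_univ.exists_isMinOn univ_nonempty F.continuous.continuousOn
  obtain ⟨q, -, hq⟩ := isCompact_univ.exists_isMaxOn univ_nonempty F.continuous.continuousOn
  refine ⟨ω (jointCfc f x) / ω 1, hJ.out (hFJ p) (hFJ q)
    ⟨(le_div_iff₀ hω).2 ?_, (div_le_iff₀ hω).2 ?_⟩, (mul_div_cancel₀ _ hω.ne').symm⟩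
  all_goals rw [← hF, ← hx.spectralFunctional_apply, ← hconst]
  exacts [OrderHomClass.mono _ fun r => hp (mem_univ r),
    OrderHomClass.mono _ fun r => hq (mem_univ r)]

lemma exists_bounds_of_spectrum_subset [Nontrivial C] {y : C} (hy : IsSelfAdjoint y) {K : Set ℝ}
    (hK : spectrum ℝ y ⊆ K) : ∃ r ∈ K, ∃ s ∈ K, algebraMap ℝ C r ≤ y ∧ y ≤ algebraMap ℝ C s := by
  have hne : (spectrum ℝ y).Nonempty := ContinuousFunctionalCalculus.spectrum_nonempty y hy
  have hcp : IsCompact (spectrum ℝ y) := ContinuousFunctionalCalculus.isCompact_spectrum y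
  obtain ⟨r, hr, hr'⟩ := hcp.exists_isLeast hne
  obtain ⟨s, hs, hs'⟩ := hcp.exists_isGreatest hne
  exact ⟨r, hK hr, s, hK hs, algebraMap_le_of_le_spectrum fun t ht => hr' ht,
    (le_algebraMap_iff_spectrum_le hy).2 fun t ht => hs' ht⟩

lemma convex_setOf_spectrum_subset {K : Set ℝ} (hK : K.OrdConnected) :
    Convex ℝ {y : C | IsSelfAdjoint y ∧ spectrum ℝ y ⊆ K} := by
  rintro y ⟨hy, hyK⟩ z ⟨hz, hzK⟩ a b ha hb hab
  have hyz : IsSelfAdjoint (a • y + b • z) := ((IsSelfAdjoint.all a).smul hy).add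
    ((IsSelfAdjoint.all b).smul hz)
  refine ⟨hyz, ?_⟩
  nontriviality C
  obtain ⟨r, hr, s, hs, hry, hys⟩ := exists_bounds_of_spectrum_subset hy hyK
  obtain ⟨t, ht, u, hu, htz, hzu⟩ := exists_bounds_of_spectrum_subset hz hzK
  have hmap : ∀ p q : ℝ, algebraMap ℝ C (a • p + b • q) =
      a • algebraMap ℝ C p + b • algebraMap ℝ C q := fun p q => by simp [Algebra.smul_def]
  have hlow : algebraMap ℝ C (a • r + b • t) ≤ a • y + b • z := by rw [hmap]; gcongr
  have hupp : a • y + b • z ≤ algebraMap ℝ C (a • s + b • u) := by rw [hmap]; gcongr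
  exact fun p hp => hK.out (hK.convex hr ht ha hb hab) (hK.convex hs hu ha hb hab)
    ⟨(algebraMap_le_iff_le_spectrum hyz).1 hlow p hp,
      (le_algebraMap_iff_spectrum_le hyz).1 hupp p hp⟩

lemma pinchedLE_of_tracial {ω : C →ₚ[ℝ] ℝ} (hω : ∀ a, ω (star a * a) = ω (a * star a)) {y : C}
    (hy : IsSelfAdjoint y) : PinchedLE ω y (ω y) := by
  intro m d hd
  obtain ⟨s, hs⟩ := CStarAlgebra.nonneg_iff_eq_star_mul_self.1
    (neg_le_iff_add_nonneg.1 hy.neg_algebraMap_norm_le_self)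
  have hconj : ∀ k,
      conjFunctional ω (d k) (star s * s) = ω (s * (d k * d k) * star s) := fun k => by
    simpa only [conjFunctional_apply, star_mul, (hd.isSelfAdjoint k).star_eq, mul_assoc] using
      hω (s * d k)
  have hsum : ∑ k, conjFunctional ω (d k) (star s * s) = ω (star s * s) := by
    simp_rw [hconj, ← map_sum, ← Finset.sum_mul, ← Finset.mul_sum, hd.sum_mul_self, mul_one, hω]
  simp_rw [← hs, Algebra.algebraMap_eq_smul_one, map_add, map_smul, Finset.sum_add_distrib,
    ← Finset.smul_sum, hd.sum_conjFunctional_one] at hsum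
  exact (add_right_cancel hsum).le

end Order

section TracialState

variable {A : Type*} [CStarAlgebra A] [PartialOrder A] [StarOrderedRing A] {n : ℕ}
  {K : Fin n → Set ℝ} {f : (Fin n → ℝ) → ℝ} {e l : ℝ → ℝ} {I : Set ℝ}

lemma EllConvexOn.mapsTo_image {E : Type*} [AddCommGroup E] [Module ℝ E] {S : Set E} {F : E → ℝ}
    (hF : EllConvexOn e I S F) : MapsTo F S (e '' I) := by
  obtain ⟨g, -, hgI, hFg⟩ := hF
  exact fun x hx => ⟨g x, hgI hx, (hFg hx).symm⟩

theorem ellConvexOn_tracialState (hel : IsEllPair e l I)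
    (hl : ConvexOn ℝ (interior (e '' I)) (ellQuot l)) (hK : ∀ i, (K i).OrdConnected)
    (hf : ContinuousOn f (univ.pi K)) (hfl : EllConvexOn e I (univ.pi K) f) {S : Set (Fin n → A)}
    (hS : Convex ℝ S) (hSK : ∀ x ∈ S, IsJointTuple K x) {τ : A →ₗ[ℂ] ℂ} (hτ : IsTracialState τ) :
    EllConvexOn e I S fun x => (τ (jointCfc f x)).re := by
  let ω : A →ₚ[ℝ] ℝ := .mk₀ (Complex.reLm ∘ₗ τ.restrictScalars ℝ) fun a ha =>
    (Complex.le_def.1 (hτ.nonneg a ha)).1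
  have hω1 : ω 1 = 1 := congrArg Complex.re hτ.map_one
  have hωmem : MapsTo (fun x => ω (jointCfc f x)) S (e '' I) := fun x hx => by
    obtain ⟨t, ht, hxt⟩ := (hSK x hx).exists_apply_jointCfc_eq_mul hf hel.convex_image.ordConnected
      hfl.mapsTo_image (hω1 ▸ one_pos)
    simpa [hxt, hω1] using ht
  have hωx : ∀ x ∈ S, PinchedLE ω (jointCfc f x) (e (l (ω (jointCfc f x)))) := fun x hx => by
    rw [hel.invOn.2 (hωmem hx)]
    exact pinchedLE_of_tracial (fun a => congrArg Complex.re (hτ.tracial a))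
      ((hSK x hx).isSelfAdjoint_jointCfc hf)
  refine hel.ellConvexOn_of_le hS hωmem fun x hx y hy a b ha hb hab => ?_
  exact apply_jointCfc_combo_le hel hl hK hf hfl (hω1 ▸ .one l _) ha hb hab (hSK x hx) (hSK y hy)
    (hSK _ (hS hx hy ha hb hab)) (hel.mapsTo_inv (hωmem hx)) (hel.mapsTo_inv (hωmem hy))
    (hωx x hx) (hωx y hy)

end TracialState

section Dominated

variable {C : Type*} [CStarAlgebra C] [PartialOrder C] [StarOrderedRing C] {n : ℕ}
  {K : Fin n → Set ℝ} {f : (Fin n → ℝ) → ℝ} {e l : ℝ → ℝ} {I : Set ℝ} {T : C → ℝ≥0∞}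

/-- The positive functional `ω` and the pieces of it under any pinching are dominated by the
weight `T`. -/
def IsDominated (T : C → ℝ≥0∞) (ω : C →ₚ[ℝ] ℝ) : Prop :=
  ∀ y, 0 ≤ y → T y ≠ ∞ → PinchedLE ω y (T y).toReal

/-- The weight `T` is the pointwise supremum of the positive functionals that it dominates under
pinching; this is all that is used of a trace. -/
def IsSupDominated (T : C → ℝ≥0∞) : Prop :=
  ∀ y, 0 ≤ y → ∀ c < T y, ∃ ω, IsDominated T ω ∧ c < ENNReal.ofReal (ω y)

lemma HomogeneousEllQuot.mem_of_pos {J : Set ℝ} (h : HomogeneousEllQuot l J) {r v : ℝ}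
    (hr : r ∈ J) (hr0 : 0 < r) (hv : 0 < v) : v ∈ J := by
  simpa [hr0.ne'] using h.1 (v / r) (div_pos hv hr0) r hr

lemma IsSupDominated.toReal_mem_image (hT : IsSupDominated T)
    (hT0 : 0 ∉ e '' I → ∃ y, 0 ≤ y ∧ T y ≠ 0)
    (hhom : HomogeneousEllQuot l (e '' I)) (hI : (e '' I).OrdConnected)
    (hf : ContinuousOn f (univ.pi K)) (hf0 : ∀ p ∈ univ.pi K, 0 ≤ f p)
    (hfI : MapsTo f (univ.pi K) (e '' I)) {x : Fin n → C} (hx : IsJointTuple K x)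
    (hfin : T (jointCfc f x) ≠ ∞) : (T (jointCfc f x)).toReal ∈ e '' I := by
  have hy := hx.jointCfc_nonneg hf hf0
  rcases eq_or_ne (T (jointCfc f x)) 0 with h0 | h0
  · rw [h0, ENNReal.toReal_zero]
    by_contra h0I
    obtain ⟨y, hy0, hTy⟩ := hT0 h0I
    obtain ⟨ω, hω, hωy⟩ := hT y hy0 0 (pos_iff_ne_zero.2 hTy)
    have hω1 := apply_one_pos_of_apply_pos (.of_nonneg hy0) (ENNReal.ofReal_pos.1 hωy)
    obtain ⟨t, ⟨htI, ht0⟩, hxt⟩ := hx.exists_apply_jointCfc_eq_mul hf (hI.inter ordConnected_Ici)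
      (fun p hp => ⟨hfI hp, hf0 p hp⟩ : MapsTo f _ (e '' I ∩ Ici 0)) hω1
    have hle : ω 1 * t ≤ 0 := by simpa [h0, hxt] using (hω _ hy hfin).apply_le
    exact h0I (((nonpos_of_mul_nonpos_right hle hω1).antisymm ht0) ▸ htI)
  · obtain ⟨ω, -, hωy⟩ := hT _ hy 0 (pos_iff_ne_zero.2 h0)
    rw [ENNReal.ofReal_pos] at hωy
    have hω1 := apply_one_pos_of_apply_pos (.of_nonneg hy) hωy
    obtain ⟨t, htI, hxt⟩ := hx.exists_apply_jointCfc_eq_mul hf hI hfI hω1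
    exact hhom.mem_of_pos htI (pos_of_mul_pos_right (hxt ▸ hωy) hω1.le)
      (ENNReal.toReal_pos h0 hfin)

theorem IsSupDominated.extEllConvexOn (hT : IsSupDominated T)
    (hT0 : 0 ∉ e '' I → ∃ y, 0 ≤ y ∧ T y ≠ 0)
    (hel : IsEllPair e l I) (hl : ConvexOn ℝ (interior (e '' I)) (ellQuot l))
    (hhom : HomogeneousEllQuot l (e '' I)) (hK : ∀ i, (K i).OrdConnected)
    (hf : ContinuousOn f (univ.pi K)) (hf0 : ∀ p ∈ univ.pi K, 0 ≤ f p)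
    (hfl : EllConvexOn e I (univ.pi K) f) {E : Type*} [AddCommGroup E] [Module ℝ E]
    (j : E →ₗ[ℝ] Fin n → C) {S : Set E} (hS : Convex ℝ S) (hj : ∀ x ∈ S, IsJointTuple K (j x)) :
    ExtEllConvexOn e I S fun x => T (jointCfc f (j x)) := by
  have hmem : ∀ x ∈ S, T (jointCfc f (j x)) ≠ ∞ → (T (jointCfc f (j x))).toReal ∈ e '' I :=
    fun x hx => hT.toReal_mem_image hT0 hhom hel.convex_image.ordConnected hf hf0
      hfl.mapsTo_image (hj x hx)
  refine hel.extEllConvexOn_of_le hS hmem fun x hx hxT y hy hyT a b ha hb hab => ?_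
  have hz := hj _ (hS hx hy ha hb hab)
  refine le_of_forall_lt fun c hc => ?_
  obtain ⟨ω, hω, hωc⟩ := hT _ (hz.jointCfc_nonneg hf hf0) c hc
  have hω1 : 0 < ω 1 := apply_one_pos_of_apply_pos (hz.isSelfAdjoint_jointCfc hf)
    (ENNReal.ofReal_pos.1 (bot_le.trans_lt hωc))
  have hωle : ∀ x ∈ S, T (jointCfc f (j x)) ≠ ∞ →
      PinchedLE ω (jointCfc f (j x)) (e (l (T (jointCfc f (j x))).toReal)) := fun x hx hxT => by
    rw [hel.invOn.2 (hmem x hx hxT)]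
    exact hω _ ((hj x hx).jointCfc_nonneg hf hf0) hxT
  refine hωc.trans_le (ENNReal.ofReal_le_ofReal ?_)
  rw [map_add, map_smul, map_smul] at hz ⊢
  exact apply_jointCfc_combo_le hel hl hK hf hfl (hhom.isEllScaling hω1) ha hb hab (hj x hx)
    (hj y hy) hz (hel.mapsTo_inv (hmem x hx hxT)) (hel.mapsTo_inv (hmem y hy hyT))
    (hωle x hx hxT) (hωle y hy hyT)

end Dominated

section Extension

variable {C : Type*} [CStarAlgebra C] [PartialOrder C] [StarOrderedRing C]

lemma exists_linearMap_of_additive {S : C → ℝ}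
    (hadd : ∀ a b, 0 ≤ a → 0 ≤ b → S (a + b) = S a + S b)
    (hsmul : ∀ (r : ℝ) (a : C), 0 ≤ r → 0 ≤ a → S (r • a) = r * S a) :
    ∃ ω : C →ₗ[ℝ] ℝ, ∀ a, 0 ≤ a → ω a = S a := by
  have hdec : ∀ a : C, ∃ p q : C, 0 ≤ p ∧ 0 ≤ q ∧ (realPart a : C) = p - q := fun a =>
    ⟨_, _, CFC.posPart_nonneg _, CFC.negPart_nonneg _,
      (CFC.posPart_sub_negPart _ (realPart a).2).symm⟩
  choose P N hP hN hPN using hdec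
  have hindep : ∀ a p q : C, 0 ≤ p → 0 ≤ q → (realPart a : C) = p - q →
      S (P a) - S (N a) = S p - S q := fun a p q hp hq h => by
    rw [hPN, sub_eq_sub_iff_add_eq_add] at h
    rw [sub_eq_sub_iff_add_eq_add, ← hadd _ _ (hP a) hq, h, hadd _ _ hp (hN a)]
  refine ⟨⟨⟨fun a => S (P a) - S (N a), fun a b => ?_⟩, fun r a => ?_⟩, fun a ha => ?_⟩
  · rw [hindep (a + b) (P a + P b) (N a + N b) (add_nonneg (hP a) (hP b))
      (add_nonneg (hN a) (hN b)) (by rw [map_add, AddSubgroup.coe_add, hPN, hPN]; abel),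
      hadd _ _ (hP a) (hP b), hadd _ _ (hN a) (hN b)]
    ring
  · rcases le_total 0 r with hr | hr
    · simp only [hindep (r • a) (r • P a) (r • N a) (smul_nonneg hr (hP a)) (smul_nonneg hr (hN a))
        (by rw [map_smul, selfAdjoint.val_smul, hPN, smul_sub]), hsmul _ _ hr (hP a),
        hsmul _ _ hr (hN a), RingHom.id_apply, smul_eq_mul]
      ring
    · have hr' := neg_nonneg.2 hr
      simp only [hindep (r • a) (-r • N a) (-r • P a) (smul_nonneg hr' (hN a))
        (smul_nonneg hr' (hP a)) (by rw [map_smul, selfAdjoint.val_smul, hPN]; module),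
        hsmul _ _ hr' (hP a), hsmul _ _ hr' (hN a), RingHom.id_apply, smul_eq_mul]
      ring
  · have h0 : S 0 = 0 := by simpa using hsmul 0 0 le_rfl le_rfl
    simpa [h0] using hindep a a 0 ha le_rfl
      (by rw [sub_zero]; exact (IsSelfAdjoint.of_nonneg ha).coe_realPart)

lemma exists_positiveLinearMap_of_additive {T : C → ℝ≥0∞} (hfin : ∀ a, 0 ≤ a → T a ≠ ∞)
    (hadd : ∀ a b, 0 ≤ a → 0 ≤ b → T (a + b) = T a + T b)
    (hsmul : ∀ (r : ℝ≥0) (a : C), 0 ≤ a → T ((r : ℝ) • a) = r * T a) :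
    ∃ ω : C →ₚ[ℝ] ℝ, ∀ a, 0 ≤ a → ω a = (T a).toReal := by
  obtain ⟨ω, hω⟩ := exists_linearMap_of_additive (S := fun a => (T a).toReal)
    (fun a b ha hb => by simp only [hadd a b ha hb, ENNReal.toReal_add (hfin a ha) (hfin b hb)])
    (fun r a hr ha => by
      lift r to ℝ≥0 using hr
      simp only [hsmul r a ha, ENNReal.toReal_mul, ENNReal.coe_toReal])
  exact ⟨.mk₀ ω fun a ha => hω a ha ▸ ENNReal.toReal_nonneg, hω⟩

end Extension

namespace IsDenseLscTrace

section Weight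

variable {A : Type*} [NonUnitalCStarAlgebra A] [PartialOrder A] [StarOrderedRing A] {τ : A → ℝ≥0∞}

lemma mono (hτ : IsDenseLscTrace τ) {a b : A} (ha : 0 ≤ a) (hab : a ≤ b) : τ a ≤ τ b := by
  rw [← add_sub_cancel a b, hτ.map_add a (b - a) ha (sub_nonneg.2 hab)]
  exact le_self_add

lemma apply_ne_top_of_le_smul (hτ : IsDenseLscTrace τ) {a b : A} (ha : 0 ≤ a) (hb : 0 ≤ b)
    (hbτ : τ b ≠ ∞) {r : ℝ} (hr : 0 ≤ r) (hab : a ≤ r • b) : τ a ≠ ∞ := by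
  lift r to ℝ≥0 using hr
  refine ne_top_of_le_ne_top ?_ (hτ.mono ha hab)
  rw [hτ.map_smul r b hb]
  exact ENNReal.mul_ne_top ENNReal.coe_ne_top hbτ

lemma map_sum {m : ℕ} (hτ : IsDenseLscTrace τ) {a : Fin m → A} (ha : ∀ k, 0 ≤ a k) :
    τ (∑ k, a k) = ∑ k, τ (a k) := by
  induction m with
  | zero => simpa using hτ.map_zero
  | succ m ih =>
    rw [Fin.sum_univ_succ, Fin.sum_univ_succ,
      hτ.map_add _ _ (ha 0) (Finset.sum_nonneg fun k _ => ha k.succ), ih fun k => ha k.succ]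

end Weight

section Unital

variable {A : Type*} [CStarAlgebra A] [PartialOrder A] [StarOrderedRing A] {τ : A → ℝ≥0∞}

lemma apply_one_ne_top (hτ : IsDenseLscTrace τ) : τ 1 ≠ ∞ := by
  obtain ⟨a, ⟨ha, haτ⟩, hdist⟩ := Metric.mem_closure_iff.1 (hτ.dense (zero_le_one (α := A))) (1 / 2)
    (by norm_num)
  have hsub : (1 : A) - a ≤ (1 / 2 : ℝ) • 1 := by
    rw [← Algebra.algebraMap_eq_smul_one]
    exact ((IsSelfAdjoint.one A).sub (.of_nonneg ha)).le_algebraMap_norm_self.trans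
      (algebraMap_mono A (dist_eq_norm (1 : A) a ▸ hdist.le))
  refine hτ.apply_ne_top_of_le_smul zero_le_one ha haτ.ne zero_le_two ?_
  calc (1 : A) = (2 : ℝ) • (1 - (1 / 2 : ℝ) • 1) := by module
    _ ≤ (2 : ℝ) • a := by gcongr; exact sub_le_comm.1 hsub

lemma isSupDominated (hτ : IsDenseLscTrace τ) : IsSupDominated τ := by
  have hfin : ∀ a, 0 ≤ a → τ a ≠ ∞ := fun a ha =>
    hτ.apply_ne_top_of_le_smul ha zero_le_one hτ.apply_one_ne_top (norm_nonneg a)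
      (Algebra.algebraMap_eq_smul_one (A := A) ‖a‖ ▸
        (IsSelfAdjoint.of_nonneg ha).le_algebraMap_norm_self)
  obtain ⟨ω, hω⟩ := exists_positiveLinearMap_of_additive hfin hτ.map_add hτ.map_smul
  refine fun y hy c hc => ⟨ω, fun a ha _ => hω a ha ▸ pinchedLE_of_tracial (fun b => ?_)
    (.of_nonneg ha), by rwa [hω y hy, ENNReal.ofReal_toReal (hfin y hy)]⟩
  rw [hω _ (star_mul_self_nonneg b), hω _ (mul_star_self_nonneg b), hτ.tracial]

end Unital
end IsDenseLscTrace

section Compression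

variable {A : Type*} [NonUnitalCStarAlgebra A]

/-- The map `y ↦ v⋆ * y * v` from the unitization of `A` to the ideal `A`. -/
noncomputable def compress (v : A) : Unitization ℂ A →ₗ[ℝ] A :=
  Unitization.sndHom ℝ ℂ A ∘ₗ
    LinearMap.mulLeftRight ℝ (star (v : Unitization ℂ A), (v : Unitization ℂ A))

lemma inr_compress (v : A) (y : Unitization ℂ A) :
    (compress v y : Unitization ℂ A) = star (v : Unitization ℂ A) * y * v := by
  refine Unitization.ext ?_ rfl
  simp

lemma compress_inr (v a : A) : compress v (a : Unitization ℂ A) = star v * a * v :=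
  Unitization.inr_injective (R := ℂ) <| by simp [inr_compress]

lemma compress_one (v : A) : compress v 1 = star v * v :=
  Unitization.inr_injective (R := ℂ) <| by simp [inr_compress]

/-- Take `b k = √y * d k * v`; then `b k * star (b k) ≤ √y * d k * d k * √y`, because
`v * star v ≤ 1`. -/
lemma exists_compress_pinching_eq_star_mul_self {v : A} (hv : ‖v‖ ≤ 1) {y : Unitization ℂ A}
    (hy : 0 ≤ y) {m : ℕ} {d : Fin m → Unitization ℂ A} (hd : IsPinching d) :
    ∃ b : Fin m → A, (∀ k, compress v (star (d k) * y * d k) = star (b k) * b k) ∧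
      ((∑ k, b k * star (b k) : A) : Unitization ℂ A) ≤ y := by
  set s := CFC.sqrt y
  have hs : star s = s := (IsSelfAdjoint.of_nonneg (CFC.sqrt_nonneg y)).star_eq
  have hss : s * s = y := CFC.sqrt_mul_sqrt_self y
  have hds : ∀ k, star (d k) = d k := fun k => (hd.isSelfAdjoint k).star_eq
  have hv1 : (v : Unitization ℂ A) * star (v : Unitization ℂ A) ≤ 1 := by
    rw [← CStarAlgebra.norm_le_one_iff_of_nonneg _ (mul_star_self_nonneg _),
      CStarRing.norm_self_mul_star, Unitization.norm_inr]
    exact mul_le_one₀ hv (norm_nonneg _) hv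
  let b : Fin m → A := fun k => (s * d k * (v : Unitization ℂ A)).snd
  have hb : ∀ k, (b k : Unitization ℂ A) = s * d k * v := fun k =>
    Unitization.ext (by simp) rfl
  refine ⟨b, fun k => Unitization.inr_injective (R := ℂ) ?_, ?_⟩
  · simp only [inr_compress, Unitization.inr_mul, Unitization.inr_star, hb, star_mul, hs, ← hss,
      mul_assoc]
  calc ((∑ k, b k * star (b k) : A) : Unitization ℂ A)
      = ∑ k, (s * d k) * (v * star (v : Unitization ℂ A)) * star (s * d k) := by
        rw [← Unitization.inrHom_apply ℂ, map_sum]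
        simp only [Unitization.inrHom_apply, Unitization.inr_mul, Unitization.inr_star, hb,
          star_mul, mul_assoc]
    _ ≤ ∑ k, (s * d k) * 1 * star (s * d k) :=
        Finset.sum_le_sum fun k _ => star_right_conjugate_le_conjugate hv1 _
    _ = s * (∑ k, d k * d k) * s := by
        simp only [Finset.mul_sum, Finset.sum_mul, star_mul, hs, hds, mul_one, mul_assoc]
    _ = y := by rw [hd.sum_mul_self, mul_one, hss]

variable [PartialOrder A] [StarOrderedRing A]

lemma compress_nonneg (v : A) {y : Unitization ℂ A} (hy : 0 ≤ y) : 0 ≤ compress v y := by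
  rw [← Unitization.inr_nonneg_iff, inr_compress]
  exact star_left_conjugate_nonneg hy _

lemma compress_mono (v : A) {y z : Unitization ℂ A} (hyz : y ≤ z) :
    compress v y ≤ compress v z := by
  rw [← sub_nonneg, ← map_sub]
  exact compress_nonneg v (sub_nonneg.2 hyz)

lemma compress_le_norm_smul (v : A) {y : Unitization ℂ A} (hy : 0 ≤ y) :
    compress v y ≤ ‖y‖ • (star v * v) := by
  rw [← compress_one, ← map_smul, ← Algebra.algebraMap_eq_smul_one]
  exact compress_mono v (IsSelfAdjoint.of_nonneg hy).le_algebraMap_norm_self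

lemma mul_self_le_self {v : A} (hv0 : 0 ≤ v) (hv1 : ‖v‖ ≤ 1) : v * v ≤ v := by
  have hv0' : (0 : Unitization ℂ A) ≤ v := Unitization.inr_nonneg_iff.2 hv0
  have hv1' : (v : Unitization ℂ A) ≤ 1 :=
    (CStarAlgebra.norm_le_one_iff_of_nonneg _ hv0').1 ((Unitization.norm_inr v).trans_le hv1)
  have hvs : IsSelfAdjoint v := .of_nonneg hv0
  rw [← Unitization.inr_le_iff _ _ (hvs.mul_self_nonneg.isSelfAdjoint) hvs, Unitization.inr_mul]
  simpa [sq] using CStarAlgebra.pow_antitone hv0' hv1' one_le_two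

lemma tendsto_conj_approximateUnit (a : A) :
    Tendsto (fun v => v * a * v) (CStarAlgebra.approximateUnit A) (𝓝 a) := by
  have hl := CStarAlgebra.increasingApproximateUnit A
  have hbdd : IsBoundedUnder (· ≤ ·) (CStarAlgebra.approximateUnit A) (norm ∘ fun v : A => v) :=
    ⟨1, hl.eventually_norm⟩
  have hright : Tendsto (fun v => a * v - a) (CStarAlgebra.approximateUnit A) (𝓝 0) := by
    simpa using (hl.tendsto_mul_left a).sub_const a
  have := (isBoundedUnder_le_mul_tendsto_zero hbdd hright).add (hl.tendsto_mul_right a)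
  simpa [mul_sub, mul_assoc] using this

lemma frequently_norm_lt_one_approximateUnit :
    ∃ᶠ v in CStarAlgebra.approximateUnit A, 0 ≤ v ∧ ‖v‖ < 1 :=
  (CStarAlgebra.hasBasis_approximateUnit A).frequently_iff.2 fun {v} hv =>
    ⟨v, ⟨le_rfl, mem_closedBall_zero_iff.2 hv.2.le⟩, hv⟩

lemma le_traceExt {τ : A → ℝ≥0∞} {a : A} (ha : 0 ≤ a) {y : Unitization ℂ A}
    (hay : (a : Unitization ℂ A) ≤ y) : τ a ≤ traceExt τ y :=
  le_iSup_of_le a (le_iSup_of_le ha (le_iSup_of_le hay le_rfl))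

end Compression

namespace IsDenseLscTrace

variable {A : Type*} [NonUnitalCStarAlgebra A] [PartialOrder A] [StarOrderedRing A] {τ : A → ℝ≥0∞}

lemma exists_isDominated_compress (hτ : IsDenseLscTrace τ) {v : A} (hv : ‖v‖ ≤ 1)
    (hvτ : τ (star v * v) ≠ ∞) : ∃ ω, IsDominated (traceExt τ) ω ∧
      ∀ y, 0 ≤ y → ENNReal.ofReal (ω y) = τ (compress v y) := by
  have hfin : ∀ y : Unitization ℂ A, 0 ≤ y → τ (compress v y) ≠ ∞ := fun y hy =>
    hτ.apply_ne_top_of_le_smul (compress_nonneg v hy) (star_mul_self_nonneg v) hvτ (norm_nonneg y)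
      (compress_le_norm_smul v hy)
  have hadd : ∀ y z : Unitization ℂ A, 0 ≤ y → 0 ≤ z →
      τ (compress v (y + z)) = τ (compress v y) + τ (compress v z) := fun y z hy hz => by
    rw [_root_.map_add, hτ.map_add _ _ (compress_nonneg v hy) (compress_nonneg v hz)]
  have hsmul : ∀ (r : ℝ≥0) (y : Unitization ℂ A), 0 ≤ y →
      τ (compress v ((r : ℝ) • y)) = r * τ (compress v y) := fun r y hy => by
    rw [_root_.map_smul, hτ.map_smul _ _ (compress_nonneg v hy)]
  obtain ⟨ω, hω⟩ := exists_positiveLinearMap_of_additive hfin hadd hsmul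
  have hωτ : ∀ y, 0 ≤ y → ENNReal.ofReal (ω y) = τ (compress v y) := fun y hy => by
    rw [hω y hy, ENNReal.ofReal_toReal (hfin y hy)]
  refine ⟨ω, fun y hy hyT m d hd => ?_, hωτ⟩
  have hpos : ∀ k, 0 ≤ star (d k) * y * d k := fun k => star_left_conjugate_nonneg hy (d k)
  obtain ⟨b, hb, hby⟩ := exists_compress_pinching_eq_star_mul_self hv hy hd
  have hbpos : ∀ k, 0 ≤ b k * star (b k) := fun k => mul_star_self_nonneg (b k)
  rw [← ENNReal.ofReal_le_iff_le_toReal hyT]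
  calc ENNReal.ofReal (∑ k, ω (star (d k) * y * d k))
      = ∑ k, ENNReal.ofReal (ω (star (d k) * y * d k)) :=
        ENNReal.ofReal_sum_of_nonneg fun k _ => map_nonneg ω (hpos k)
    _ = ∑ k, τ (b k * star (b k)) := by simp only [hωτ _ (hpos _), hb, hτ.tracial]
    _ = τ (∑ k, b k * star (b k)) := (hτ.map_sum hbpos).symm
    _ ≤ traceExt τ y := le_traceExt (Finset.sum_nonneg fun k _ => hbpos k) hby

lemma exists_conj_mem (hτ : IsDenseLscTrace τ) {a : A} {U : Set A} (hU : IsOpen U)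
    (haU : a ∈ U) : ∃ v : A, 0 ≤ v ∧ ‖v‖ ≤ 1 ∧ τ v ≠ ∞ ∧ v * a * v ∈ U := by
  obtain ⟨v, ⟨hv0, hv1⟩, hvU⟩ := (frequently_norm_lt_one_approximateUnit.and_eventually
    ((tendsto_conj_approximateUnit a).eventually (hU.mem_nhds haU))).exists
  have hopen : IsOpen ((fun v => v * a * v) ⁻¹' U ∩ Metric.ball 0 1) :=
    (hU.preimage (by fun_prop)).inter Metric.isOpen_ball
  obtain ⟨w, ⟨hwU, hw1⟩, hw0, hwτ⟩ :=
    mem_closure_iff.1 (hτ.dense hv0) _ hopen ⟨hvU, mem_ball_zero_iff.2 hv1⟩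
  exact ⟨w, hw0, (mem_ball_zero_iff.1 hw1).le, hwτ.ne, hwU⟩

lemma isSupDominated_traceExt (hτ : IsDenseLscTrace τ) : IsSupDominated (traceExt τ) := by
  intro y hy c hc
  simp only [traceExt, lt_iSup_iff] at hc
  obtain ⟨a, ha, hay, hca⟩ := hc
  obtain ⟨U, hUo, haU, hU⟩ := mem_nhdsWithin.1 (hτ.lsc a ha c hca)
  obtain ⟨v, hv0, hv1, hvτ, hvU⟩ := hτ.exists_conj_mem hUo haU
  have hvs : star v = v := (IsSelfAdjoint.of_nonneg hv0).star_eq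
  have hvvτ : τ (star v * v) ≠ ∞ := by
    rw [hvs]
    exact ne_top_of_le_ne_top hvτ
      (hτ.mono (IsSelfAdjoint.of_nonneg hv0).mul_self_nonneg (mul_self_le_self hv0 hv1))
  obtain ⟨ω, hω, hωτ⟩ := hτ.exists_isDominated_compress hv1 hvvτ
  have hva : 0 ≤ star v * a * v := star_left_conjugate_nonneg ha v
  refine ⟨ω, hω, ?_⟩
  calc c < τ (star v * a * v) := hU ⟨by rwa [hvs], hva⟩
    _ ≤ τ (compress v y) := hτ.mono hva (compress_inr v a ▸ compress_mono v hay)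
    _ = ENNReal.ofReal (ω y) := (hωτ y hy).symm

end IsDenseLscTrace

section Tuples

variable {A : Type*} {n : ℕ} {K : Fin n → Set ℝ}

lemma MutuallyCommuting.commute [NonUnitalCStarAlgebra A] {B : Fin n → NonUnitalStarSubalgebra ℂ A}
    (hB : MutuallyCommuting B) {x : Fin n → A} (hx : ∀ i, x i ∈ B i) (i j : Fin n) :
    Commute (x i) (x j) := by
  rcases eq_or_ne i j with rfl | hij
  · exact .refl _
  · exact hB i j hij _ (hx i) _ (hx j)

lemma convex_nonUnitalStarSubalgebra [NonUnitalCStarAlgebra A] (B : NonUnitalStarSubalgebra ℂ A) :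
    Convex ℝ (B : Set A) := fun x hx y hy a b _ _ _ =>
  add_mem (by simpa using SMulMemClass.smul_mem (a : ℂ) hx)
    (by simpa using SMulMemClass.smul_mem (b : ℂ) hy)

lemma isJointTuple_of_mem_saTuples [CStarAlgebra A] {B : Fin n → NonUnitalStarSubalgebra ℂ A}
    (hB : MutuallyCommuting B) {x : Fin n → A} (hx : x ∈ saTuples B K) : IsJointTuple K x where
  isSelfAdjoint i := (hx i).2.1
  commute := hB.commute fun i => (hx i).1
  spectrum_subset i := (hx i).2.2

lemma convex_saTuples [CStarAlgebra A] [PartialOrder A] [StarOrderedRing A]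
    (B : Fin n → NonUnitalStarSubalgebra ℂ A) (hK : ∀ i, (K i).OrdConnected) :
    Convex ℝ (saTuples B K) := fun _ hx _ hy _ _ ha hb hab i =>
  ((convex_nonUnitalStarSubalgebra (B i)).inter (convex_setOf_spectrum_subset (hK i)))
    (hx i) (hy i) ha hb hab

/-- The embedding of tuples in `A` into tuples in the unitization of `A`. -/
noncomputable def inrTuple (A : Type*) [NonUnitalCStarAlgebra A] (n : ℕ) :
    (Fin n → A) →ₗ[ℝ] (Fin n → Unitization ℂ A) :=
  (Unitization.inrHom ℝ ℂ A).compLeft (Fin n)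

variable [NonUnitalCStarAlgebra A] {B : Fin n → NonUnitalStarSubalgebra ℂ A}

lemma mem_saTuplesNonUnital_iff {x : Fin n → A} :
    x ∈ saTuplesNonUnital B K ↔ ∀ i, x i ∈ B i ∧ IsSelfAdjoint (x i : Unitization ℂ A) ∧
      spectrum ℝ (x i : Unitization ℂ A) ⊆ K i := by
  simp only [saTuplesNonUnital, mem_ofPred_eq, Unitization.isSelfAdjoint_inr,
    Unitization.quasispectrum_eq_spectrum_inr' ℝ ℂ]

lemma isJointTuple_inr_of_mem_saTuplesNonUnital (hB : MutuallyCommuting B) {x : Fin n → A}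
    (hx : x ∈ saTuplesNonUnital B K) : IsJointTuple K fun i => (x i : Unitization ℂ A) where
  isSelfAdjoint i := (mem_saTuplesNonUnital_iff.1 hx i).2.1
  commute i j := (hB.commute (fun i => (hx i).1) i j).map (Unitization.inrNonUnitalAlgHom ℂ A)
  spectrum_subset i := (mem_saTuplesNonUnital_iff.1 hx i).2.2

lemma convex_saTuplesNonUnital (B : Fin n → NonUnitalStarSubalgebra ℂ A)
    (hK : ∀ i, (K i).OrdConnected) :
    Convex ℝ (saTuplesNonUnital B K) := fun x hx y hy _ _ ha hb hab =>
  mem_saTuplesNonUnital_iff.2 fun i => by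
    rw [mem_saTuplesNonUnital_iff] at hx hy
    exact ((convex_nonUnitalStarSubalgebra (B i)).inter
      ((convex_setOf_spectrum_subset (hK i)).linear_preimage (Unitization.inrHom ℝ ℂ A)))
      (hx i) (hy i) ha hb hab

end Tuples

theorem theorem3_general {n : ℕ} (K : Fin n → Set ℝ) (hK : ∀ i, (K i).OrdConnected)
    (f : (Fin n → ℝ) → ℝ) (hf : ContinuousOn f (Set.univ.pi K))
    (e l : ℝ → ℝ) (I : Set ℝ) (hel : IsEllPair e l I)
    (hfl : EllConvexOn e I (Set.univ.pi K) f)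
    (hl : ConvexOn ℝ (interior (e '' I)) (ellQuot l)) :
    (∀ (A : Type*) [CStarAlgebra A] [PartialOrder A] [StarOrderedRing A]
      (S : Set (Fin n → A)), Convex ℝ S → (∀ x ∈ S, IsJointTuple K x) →
      ∀ τ : A →ₗ[ℂ] ℂ, IsTracialState τ →
        EllConvexOn e I S (fun x => (τ (jointCfc f x)).re)) ∧
    (HomogeneousEllQuot l (e '' I) → (∀ p ∈ Set.univ.pi K, 0 ≤ f p) →
      (∀ (A : Type*) [CStarAlgebra A] [PartialOrder A] [StarOrderedRing A]
        (S : Set (Fin n → A)), Convex ℝ S → (∀ x ∈ S, IsJointTuple K x) →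
        ∀ τ : A → ℝ≥0∞, IsDenseLscTrace τ → (0 ∉ e '' I → ∃ a, 0 ≤ a ∧ τ a ≠ 0) →
          ExtEllConvexOn e I S (fun x => τ (jointCfc f x))) ∧
      (∀ (A : Type*) [NonUnitalCStarAlgebra A] [PartialOrder A] [StarOrderedRing A]
        (S : Set (Fin n → A)), Convex ℝ S →
        (∀ x ∈ S, IsJointTuple K fun i => (x i : Unitization ℂ A)) →
        ∀ τ : A → ℝ≥0∞, IsDenseLscTrace τ → (0 ∉ e '' I → ∃ a, 0 ≤ a ∧ τ a ≠ 0) →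
          ExtEllConvexOn e I S
            (fun x => traceExt τ (jointCfc f fun i => (x i : Unitization ℂ A))))) := by
  refine ⟨fun A _ _ _ S hS hSK τ hτ => ellConvexOn_tracialState hel hl hK hf hfl hS hSK hτ,
    fun hhom hf0 => ⟨fun A _ _ _ S hS hSK τ hτ hτ0 => ?_, fun A _ _ _ S hS hSK τ hτ hτ0 => ?_⟩⟩
  · exact hτ.isSupDominated.extEllConvexOn hτ0 hel hl hhom hK hf hf0 hfl .id hS hSK
  · have hτ0' : 0 ∉ e '' I → ∃ y, 0 ≤ y ∧ traceExt τ y ≠ 0 := fun h0 => by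
      obtain ⟨a, ha, haτ⟩ := hτ0 h0
      exact ⟨a, Unitization.inr_nonneg_iff.2 ha, by rwa [traceExt_inr hτ ha]⟩
    exact hτ.isSupDominated_traceExt.extEllConvexOn hτ0' hel hl hhom hK hf hf0 hfl
      (inrTuple A n) hS hSK

theorem theorem3 {n : ℕ} (K : Fin n → Set ℝ) (hK : ∀ i, (K i).OrdConnected)
    (f : (Fin n → ℝ) → ℝ) (hf : ContinuousOn f (Set.univ.pi K))
    (e l : ℝ → ℝ) (I : Set ℝ) (hel : IsEllPair e l I)
    (hfl : EllConvexOn e I (Set.univ.pi K) f)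
    (hl : ConvexOn ℝ (interior (e '' I)) (ellQuot l)) :
    -- tracial states (on unital algebras)
    (∀ (A : Type*) [CStarAlgebra A] [PartialOrder A] [StarOrderedRing A]
      (B : Fin n → NonUnitalStarSubalgebra ℂ A), (∀ i, IsClosed (B i : Set A)) →
      MutuallyCommuting B →
      ∀ τ : A →ₗ[ℂ] ℂ, IsTracialState τ →
        EllConvexOn e I (saTuples B K) (fun x => (τ (jointCfc f x)).re)) ∧
    (HomogeneousEllQuot l (e '' I) → (∀ p ∈ Set.univ.pi K, 0 ≤ f p) →
      -- densely defined, lower semicontinuous traces on unital algebras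
      (∀ (A : Type*) [CStarAlgebra A] [PartialOrder A] [StarOrderedRing A]
        (B : Fin n → NonUnitalStarSubalgebra ℂ A), (∀ i, IsClosed (B i : Set A)) →
        MutuallyCommuting B →
        ∀ τ : A → ℝ≥0∞, IsDenseLscTrace τ → (0 ∉ e '' I → ∃ a, 0 ≤ a ∧ τ a ≠ 0) →
          ExtEllConvexOn e I (saTuples B K) (fun x => τ (jointCfc f x))) ∧
      -- and on algebras without unit, where `f(x)` lies in the unitization
      (∀ (A : Type*) [NonUnitalCStarAlgebra A] [PartialOrder A] [StarOrderedRing A]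
        (B : Fin n → NonUnitalStarSubalgebra ℂ A), (∀ i, IsClosed (B i : Set A)) →
        MutuallyCommuting B →
        ∀ τ : A → ℝ≥0∞, IsDenseLscTrace τ → (0 ∉ e '' I → ∃ a, 0 ≤ a ∧ τ a ≠ 0) →
          ExtEllConvexOn e I (saTuplesNonUnital B K)
            (fun x => traceExt τ (jointCfc f fun i => (x i : Unitization ℂ A))))) := by
  obtain ⟨hstate, htrace⟩ := theorem3_general K hK f hf e l I hel hfl hl
  exact ⟨fun A _ _ _ B _ hB => hstate A _ (convex_saTuples B hK) fun _ =>
      isJointTuple_of_mem_saTuples hB,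
    fun hhom hf0 => ⟨fun A _ _ _ B _ hB => (htrace hhom hf0).1 A _ (convex_saTuples B hK) fun _ =>
      isJointTuple_of_mem_saTuples hB,
    fun A _ _ _ B _ hB => (htrace hhom hf0).2 A _ (convex_saTuplesNonUnital B hK) fun _ =>
      isJointTuple_inr_of_mem_saTuplesNonUnital hB⟩⟩
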